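/- Let $\varphi(z)=\tanh z$ and $\psi(z)=\operatorname{sech} z$ on $\mathbb R$, and for $\mu\in\mathbb R$ consider on $L^2(\mathbb R;\mathbb C)$ the operators $$C=-\partial_z^2-6\psi^2+4,\qquad D=D_\mu=-\partial_z^2-2\psi^2+\mu+1,$$ both with domain $H^2(\mathbb R)$. Let $D^{-1}$ be the inverse of $D$; when $D$ has a nontrivial kernel, as for $\mu=0$ (where the kernel is spanned by $\psi$), $D^{-1}f$ denotes the solution $u\in H^2(\mathbb R)$ of $Du=f$ that is orthogonal to $\ker D$. Set $$X_*(\mu)=\{D^{-1}\varphi'\}^{\perp}\subset L^2(\mathbb R)\quad(\mu\neq 0),\qquad X_*(0)=\{\psi\}^{\perp}.$$ Then there exists $\mu_*>0$ such that for every $\mu\in[-\mu_*,3]$ the minimum $$\rho_*(\mu)=\min_{P\in X_*(\mu)\cap H^2(\mathbb R),\,P\neq 0}\ \frac{\langle CP,P\rangle}{\langle D^{-1}P,P\rangle}$$ exists and $\rho_*(\mu)>0$. -/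

import Mathlib

open MeasureTheory TemperedDistribution
open scoped ENNReal SchwartzMap LineDeriv InnerProductSpace

noncomputable section

namespace PNLS

/-- The complex Hilbert space `L²(ℝ)`. -/
abbrev L2 : Type := Lp ℂ 2 (volume : Measure ℝ)

/-- The profile `φ(z) = tanh z` of the dark soliton. -/
def phi (z : ℝ) : ℝ := Real.tanh z

/-- The function `ψ(z) = sech z`. -/
def psi (z : ℝ) : ℝ := (Real.cosh z)⁻¹

lemma psi_continuous : Continuous psi :=
  Real.continuous_cosh.inv₀ fun x => (Real.cosh_pos x).ne'

lemma psi_pos (z : ℝ) : 0 < psi z := inv_pos.2 (Real.cosh_pos z)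

lemma psi_le_one (z : ℝ) : psi z ≤ 1 := inv_le_one_of_one_le₀ (Real.one_le_cosh z)

lemma deriv_phi : deriv phi = fun z => psi z ^ 2 := by
  funext z
  have h : phi = fun x => Real.sinh x / Real.cosh x := by
    funext x; exact Real.tanh_eq_sinh_div_cosh x
  have hc := (Real.cosh_pos z).ne'
  rw [h, deriv_fun_div Real.differentiable_sinh.differentiableAt
    Real.differentiable_cosh.differentiableAt hc, Real.deriv_sinh, Real.deriv_cosh, psi, inv_pow,
    ← one_div]
  congr 1
  have := Real.cosh_sq z
  nlinarith

lemma psi_integrable_sq : Integrable (fun z => psi z ^ 2) := by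
  refine (integrable_inv_one_add_sq).mono' (psi_continuous.pow 2).aestronglyMeasurable
    (Filter.Eventually.of_forall fun z => ?_)
  have h1 : 1 + z ^ 2 ≤ Real.cosh z ^ 2 := by
    rw [Real.cosh_sq]
    have : z ^ 2 ≤ Real.sinh z ^ 2 := by
      rw [sq_le_sq]
      rcases le_total 0 z with hz | hz
      · rw [abs_of_nonneg hz, abs_of_nonneg (Real.sinh_nonneg_iff.2 hz)]
        exact Real.self_le_sinh_iff.2 hz
      · rw [abs_of_nonpos hz, abs_of_nonpos (Real.sinh_nonpos_iff.2 hz)]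
        exact neg_le_neg (Real.sinh_le_self_iff.2 hz)
    linarith
  rw [Real.norm_of_nonneg (by positivity), psi, inv_pow]
  exact inv_anti₀ (by positivity) h1

lemma psi_memLp : MemLp (fun z => (psi z : ℂ)) 2 := by
  have : MemLp psi 2 :=
    (memLp_two_iff_integrable_sq psi_continuous.aestronglyMeasurable).2 psi_integrable_sq
  exact this.ofReal

lemma dphi_memLp : MemLp (fun z => ((deriv phi z : ℝ) : ℂ)) 2 := by
  rw [deriv_phi]
  refine psi_memLp.mono (Complex.continuous_ofReal.comp
    (psi_continuous.pow 2)).aestronglyMeasurable (Filter.Eventually.of_forall fun z => ?_)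
  rw [Complex.norm_real, Complex.norm_real, Real.norm_of_nonneg (by positivity),
    Real.norm_of_nonneg (psi_pos z).le]
  nlinarith [psi_pos z, psi_le_one z]

/-- `ψ` as an element of `L²(ℝ)`. -/
def psiL2 : L2 := psi_memLp.toLp _

/-- `φ'` as an element of `L²(ℝ)`. -/
def dphiL2 : L2 := dphi_memLp.toLp _

lemma psi_sq_mul_memLp (u : L2) : MemLp (fun z => ((psi z ^ 2 : ℝ) : ℂ) * u z) 2 := by
  refine (Lp.memLp u).mono ((Complex.continuous_ofReal.comp
    (psi_continuous.pow 2)).aestronglyMeasurable.mul (Lp.aestronglyMeasurable u))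
    (Filter.Eventually.of_forall fun z => ?_)
  rw [norm_mul, Complex.norm_real, Real.norm_of_nonneg (by positivity)]
  exact mul_le_of_le_one_left (norm_nonneg _) (pow_le_one₀ (psi_pos z).le (psi_le_one z))

/-- Multiplication by `ψ²` on `L²(ℝ)`. -/
def mulPsiSq : L2 →ₗ[ℂ] L2 where
  toFun u := (psi_sq_mul_memLp u).toLp _
  map_add' u v := by
    rw [← MemLp.toLp_add]
    refine MemLp.toLp_congr _ _ ?_
    filter_upwards [Lp.coeFn_add u v] with z hz
    simp only [hz, Pi.add_apply, mul_add]
  map_smul' c u := by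
    rw [RingHom.id_apply, ← MemLp.toLp_const_smul]
    refine MemLp.toLp_congr _ _ ?_
    filter_upwards [Lp.coeFn_smul c u] with z hz
    simp only [hz, Pi.smul_apply, smul_eq_mul]
    ring

/-- The Sobolev space `H²(ℝ)`, as a subspace of `L²(ℝ)`. -/
def H2 : Submodule ℂ L2 where
  carrier := {u | MemSobolev 2 2 (u : 𝓢'(ℝ, ℂ))}
  zero_mem' := by
    have : ((0 : L2) : 𝓢'(ℝ, ℂ)) = 0 := by
      rw [← Lp.toTemperedDistributionCLM_apply, map_zero]
    simp [this]
  add_mem' {u v} hu hv := by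
    have : ((u + v : L2) : 𝓢'(ℝ, ℂ)) = (u : 𝓢'(ℝ, ℂ)) + (v : 𝓢'(ℝ, ℂ)) := by
      simp only [← Lp.toTemperedDistributionCLM_apply, map_add]
    simpa [this] using MemSobolev.add hu hv
  smul_mem' c u hu := by
    have : ((c • u : L2) : 𝓢'(ℝ, ℂ)) = c • (u : 𝓢'(ℝ, ℂ)) := by
      simp only [← Lp.toTemperedDistributionCLM_apply, map_smul]
    simpa [this] using MemSobolev.smul c hu

lemma exists_secondDeriv (u : H2) :
    ∃ w : L2, (w : 𝓢'(ℝ, ℂ)) = ∂_{(1 : ℝ)} (∂_{(1 : ℝ)} ((u : L2) : 𝓢'(ℝ, ℂ))) := by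
  have h : MemSobolev 2 2 ((u : L2) : 𝓢'(ℝ, ℂ)) := u.2
  have h2 := (h.lineDerivOp (m := (1 : ℝ))).lineDerivOp (m := (1 : ℝ))
  rw [show (2 - 1 - 1 : ℝ) = 0 by norm_num, memSobolev_zero_iff] at h2
  obtain ⟨w, hw⟩ := h2
  exact ⟨w, hw.symm⟩

lemma toTempered_injective {u v : L2} (h : (u : 𝓢'(ℝ, ℂ)) = (v : 𝓢'(ℝ, ℂ))) : u = v :=
  LinearMap.ker_eq_bot.1
    (Lp.ker_toTemperedDistributionCLM_eq_bot (F := ℂ) (μ := (volume : Measure ℝ)) (p := 2)) h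

/-- The second derivative `∂_z² : H²(ℝ) → L²(ℝ)`: the element of `L²(ℝ)` that equals the second
distributional derivative. -/
def secondDeriv : H2 →ₗ[ℂ] L2 where
  toFun u := (exists_secondDeriv u).choose
  map_add' u v := by
    apply toTempered_injective
    rw [(exists_secondDeriv (u + v)).choose_spec]
    simp only [← Lp.toTemperedDistributionCLM_apply, map_add, Submodule.coe_add]
    simp only [Lp.toTemperedDistributionCLM_apply, (exists_secondDeriv u).choose_spec,
      (exists_secondDeriv v).choose_spec, LineDeriv.lineDerivOp_add]
  map_smul' c u := by
    apply toTempered_injective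
    rw [(exists_secondDeriv (c • u)).choose_spec]
    simp only [← Lp.toTemperedDistributionCLM_apply, map_smul, Submodule.coe_smul,
      RingHom.id_apply]
    simp only [Lp.toTemperedDistributionCLM_apply, (exists_secondDeriv u).choose_spec,
      LineDeriv.lineDerivOp_smul]

/-- The operator `C = -∂_z² - 6ψ² + 4` with domain `H²(ℝ)`. -/
def opC : L2 →ₗ.[ℂ] L2 where
  domain := H2
  toFun := -secondDeriv - (6 : ℂ) • mulPsiSq.comp H2.subtype + (4 : ℂ) • H2.subtype

/-- The operator `D = -∂_z² - 2ψ² + μ + 1` with domain `H²(ℝ)`. -/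
def opD (μ : ℝ) : L2 →ₗ.[ℂ] L2 where
  domain := H2
  toFun := -secondDeriv - (2 : ℂ) • mulPsiSq.comp H2.subtype + ((μ + 1 : ℝ) : ℂ) • H2.subtype

/-- `u = D⁻¹ f`: `u` lies in the domain of `D`, satisfies `D u = f`, and is orthogonal to the
kernel of `D`. (The last condition is void if `D` is injective, and selects one solution if not.) -/
def IsDInv (μ : ℝ) (f : L2) (u : (opD μ).domain) : Prop :=
  opD μ u = f ∧ ∀ w : (opD μ).domain, opD μ w = 0 → ⟪(w : L2), (u : L2)⟫_ℂ = 0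

open Classical in
/-- The inverse `D⁻¹` of `D`, taken on the orthogonal complement of the kernel when `D` is not
injective; the value is `0` where there is no solution. -/
def Dinv (μ : ℝ) (f : L2) : L2 :=
  if h : ∃ u : (opD μ).domain, IsDInv μ f u then (h.choose : L2) else 0

/-- The constraint space: `X_*(μ) = {D⁻¹φ'}^⊥` for `μ ≠ 0`. For `μ = 0`, where `ψ` spans the kernel
of `D`, the direction `D⁻¹φ'` is replaced by its limit `ψ`. -/
def Xstar (μ : ℝ) : Submodule ℂ L2 :=
  if μ = 0 then (ℂ ∙ psiL2)ᗮ else (ℂ ∙ Dinv μ dphiL2)ᗮ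

/-- The values `⟨C P, P⟩ / ⟨D⁻¹ P, P⟩` of the constrained Rayleigh quotient, `P` ranging over the
nonzero elements of `X_*(μ)` in the domain of `C`. -/
def rayleighValues (μ : ℝ) : Set ℝ :=
  {r | ∃ P : opC.domain, (P : L2) ≠ 0 ∧ (P : L2) ∈ Xstar μ ∧
    r = (⟪opC P, (P : L2)⟫_ℂ).re / (⟪Dinv μ (P : L2), (P : L2)⟫_ℂ).re}

end PNLS

end

/-!
Everything is transferred to bounded operators on `L²(ℝ)`. With `J = (-∂² + 4)^(-1/2)`, defined as a
Fourier multiplier, `H²(ℝ)` is the range of `J²`, and for `P = Jg` the quotient becomes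
`⟨Ag, g⟩ / ⟨Sg, g⟩` with `A = 1 - 6Jψ²J` and `S = J D⁻¹ J`. The constraint becomes `g ⊥ Jw`, where
`X_*(μ) = w^⊥`.

*Attainment* (`exists_rayleigh_min`). The operator `ψJ` is Hilbert–Schmidt, hence compact
(`isCompactOperator_psi_opJ`), and `D⁻¹` differs from `(-∂² + μ + 1)⁻¹` by a compact operator
(`exists_inverse`, via the Fredholm alternative). So `A - ρS` is a compact perturbation of
`1 - ρ (-∂² + 4)⁻¹(-∂² + μ + 1)⁻¹`, which is coercive for `ρ < 4(μ + 1)`. A minimizing sequence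
therefore converges along a subsequence as soon as one trial vector has a quotient below `4(μ + 1)`.
The trial vector is `D(φψ^(1/4))` (`exists_trial`), a truncation of the threshold resonance `φ`; it
satisfies the constraint because it is odd. The Euler–Lagrange equation exhibits the minimizer as
an element of the range of `J`, so that `P = Jg` lies in `H²(ℝ)`.

*Signs*. For `m = 1, 2` the operator `-∂² - m(m+1)ψ² + m²` factors as `A*A` with `A = ∂ + mφ`
(`norm_darboux_sq`), and `A` annihilates only the multiples of `ψ^m`
(`exists_eq_psi_pow_of_darboux_eq_zero`). The case `m = 2` gives `C ≥ 0` with kernel contained in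
the span of `ψ² = φ'`; the case `m = 1` gives `D - μ ≥ 0` with kernel spanned by `ψ`, and a spectral
gap above it (`exists_gap`). Hence `D⁻¹` is positive on the constraint space for `μ ≥ 0`. For small
`μ < 0` the form of `D` has one negative direction, and `⟨D⁻¹φ', φ'⟩ < 0` because `⟨φ', ψ⟩ ≠ 0`; the
complement of `φ'` with respect to the form of `D⁻¹` is then a positive subspace
(`exists_constrainedInverse_of_neg`). In all cases `φ'` violates the constraint, so that the minimum
of the nonnegative quotient is not zero.
-/

noncomputable section

namespace PNLS

open FourierTransform Filter Topology
open scoped BoundedContinuousFunction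

/-! ### Multiplication operators and Fourier multipliers on `L²(ℝ)` -/

lemma bcf_mul_memLp (a : ℝ →ᵇ ℂ) (u : L2) : MemLp (fun z => a z * u z) 2 :=
  (Lp.memLp u).of_le_mul (c := ‖a‖)
    (a.continuous.aestronglyMeasurable.mul (Lp.aestronglyMeasurable u))
    (Filter.Eventually.of_forall fun z => by
      rw [norm_mul]; exact mul_le_mul_of_nonneg_right (a.norm_coe_le_norm z) (norm_nonneg _))

/-- Multiplication by a bounded continuous function, as a bounded operator on `L²(ℝ)`. -/
def mulOp (a : ℝ →ᵇ ℂ) : L2 →L[ℂ] L2 :=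
  LinearMap.mkContinuous
    { toFun := fun u => (bcf_mul_memLp a u).toLp _
      map_add' := fun u v => by
        rw [← MemLp.toLp_add]
        refine MemLp.toLp_congr _ _ ?_
        filter_upwards [Lp.coeFn_add u v] with z hz
        simp only [hz, Pi.add_apply, mul_add]
      map_smul' := fun c u => by
        rw [RingHom.id_apply, ← MemLp.toLp_const_smul]
        refine MemLp.toLp_congr _ _ ?_
        filter_upwards [Lp.coeFn_smul c u] with z hz
        simp only [hz, Pi.smul_apply, smul_eq_mul]
        ring } ‖a‖ (fun u => by
      refine Lp.norm_le_mul_norm_of_ae_le_mul ?_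
      filter_upwards [(bcf_mul_memLp a u).coeFn_toLp] with z hz
      simp only [LinearMap.coe_mk, AddHom.coe_mk]
      rw [hz, norm_mul]
      exact mul_le_mul_of_nonneg_right (a.norm_coe_le_norm z) (norm_nonneg _))

lemma coeFn_mulOp (a : ℝ →ᵇ ℂ) (u : L2) : mulOp a u =ᵐ[volume] fun z => a z * u z :=
  (bcf_mul_memLp a u).coeFn_toLp

lemma norm_mulOp_le (a : ℝ →ᵇ ℂ) : ‖mulOp a‖ ≤ ‖a‖ :=
  LinearMap.mkContinuous_norm_le _ (norm_nonneg _) _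

lemma mulOp_mul (a b : ℝ →ᵇ ℂ) (u : L2) : mulOp (a * b) u = mulOp a (mulOp b u) := by
  apply Lp.ext
  filter_upwards [coeFn_mulOp (a * b) u, coeFn_mulOp a (mulOp b u), coeFn_mulOp b u] with z h1 h2 h3
  rw [h1, h2, h3, BoundedContinuousFunction.mul_apply, mul_assoc]

lemma mulOp_add (a b : ℝ →ᵇ ℂ) (u : L2) : mulOp (a + b) u = mulOp a u + mulOp b u := by
  apply Lp.ext
  filter_upwards [coeFn_mulOp (a + b) u, coeFn_mulOp a u, coeFn_mulOp b u,
    Lp.coeFn_add (mulOp a u) (mulOp b u)] with z h1 h2 h3 h4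
  rw [h1, h4, Pi.add_apply, h2, h3, BoundedContinuousFunction.add_apply, add_mul]

lemma mulOp_smul (c : ℂ) (a : ℝ →ᵇ ℂ) (u : L2) : mulOp (c • a) u = c • mulOp a u := by
  apply Lp.ext
  filter_upwards [coeFn_mulOp (c • a) u, coeFn_mulOp a u,
    Lp.coeFn_smul c (mulOp a u)] with z h1 h2 h4
  rw [h1, h4, Pi.smul_apply, h2, BoundedContinuousFunction.smul_apply, smul_eq_mul, smul_eq_mul,
    mul_assoc]

lemma mulOp_one (u : L2) : mulOp 1 u = u := by
  apply Lp.ext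
  filter_upwards [coeFn_mulOp 1 u] with z h1
  rw [h1, BoundedContinuousFunction.coe_one, Pi.one_apply, one_mul]

lemma inner_mulOp (a : ℝ →ᵇ ℂ) (u v : L2) : ⟪mulOp a u, v⟫_ℂ = ⟪u, mulOp (star a) v⟫_ℂ := by
  rw [L2.inner_def, L2.inner_def]
  refine integral_congr_ae ?_
  filter_upwards [coeFn_mulOp a u, coeFn_mulOp (star a) v] with z h1 h2
  simp only [h1, h2, RCLike.inner_apply, map_mul, BoundedContinuousFunction.star_apply, RCLike.star_def]
  ring

/-- The Fourier multiplier with a bounded continuous symbol, as a bounded operator on `L²(ℝ)`. -/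
def fm (a : ℝ →ᵇ ℂ) : L2 →L[ℂ] L2 :=
  ((Lp.fourierTransformₗᵢ ℝ ℂ).symm.toContinuousLinearEquiv : L2 →L[ℂ] L2) ∘L mulOp a ∘L
    ((Lp.fourierTransformₗᵢ ℝ ℂ).toContinuousLinearEquiv : L2 →L[ℂ] L2)


lemma fm_apply (a : ℝ →ᵇ ℂ) (u : L2) : fm a u = 𝓕⁻ (mulOp a (𝓕 u)) := rfl

lemma norm_fm_apply (a : ℝ →ᵇ ℂ) (u : L2) : ‖fm a u‖ = ‖mulOp a (𝓕 u)‖ :=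
  (Lp.fourierTransformₗᵢ ℝ ℂ).symm.norm_map _

lemma norm_fm_le (a : ℝ →ᵇ ℂ) : ‖fm a‖ ≤ ‖a‖ :=
  ContinuousLinearMap.opNorm_le_bound _ (norm_nonneg _) fun u => by
    rw [norm_fm_apply]
    refine ((mulOp a).le_opNorm _).trans ?_
    rw [Lp.norm_fourier_eq]
    exact mul_le_mul_of_nonneg_right (norm_mulOp_le a) (norm_nonneg _)

lemma fm_mul (a b : ℝ →ᵇ ℂ) (u : L2) : fm (a * b) u = fm a (fm b u) := by
  rw [fm_apply, fm_apply, fm_apply, fourier_fourierInv_eq, mulOp_mul]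

lemma fm_add (a b : ℝ →ᵇ ℂ) (u : L2) : fm (a + b) u = fm a u + fm b u := by
  simp only [fm_apply, mulOp_add, FourierTransform.fourierInv_add]

lemma fm_smul (c : ℂ) (a : ℝ →ᵇ ℂ) (u : L2) : fm (c • a) u = c • fm a u := by
  simp only [fm_apply, mulOp_smul, FourierTransform.fourierInv_smul]

lemma fm_one (u : L2) : fm 1 u = u := by
  rw [fm_apply, mulOp_one, fourierInv_fourier_eq]

lemma inner_fm (a : ℝ →ᵇ ℂ) (u v : L2) : ⟪fm a u, v⟫_ℂ = ⟪u, fm (star a) v⟫_ℂ := by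
  rw [fm_apply, fm_apply, ← Lp.inner_fourier_eq, fourier_fourierInv_eq, inner_mulOp,
    ← Lp.inner_fourier_eq u, fourier_fourierInv_eq]

/-- `L²` multipliers agree with the multipliers on tempered distributions. -/
lemma fm_toTempered {a : ℝ →ᵇ ℂ} (ha : (a : ℝ → ℂ).HasTemperateGrowth) (u : L2) :
    ((fm a u : L2) : 𝓢'(ℝ, ℂ)) = fourierMultiplierCLM ℂ a (u : 𝓢'(ℝ, ℂ)) := by
  have h := Lp.toTemperedDistribution_smul_eq (r := 2) ha (a.memLp_top (μ := volume)) (𝓕 u)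
  have h2 : ((a.memLp_top (μ := volume)).toLp _ • (𝓕 u) : Lp ℂ 2 (volume : Measure ℝ)) = mulOp a (𝓕 u) := by
    apply Lp.ext
    filter_upwards [Lp.coeFn_lpSMul (r := 2) ((a.memLp_top (μ := volume)).toLp _) (𝓕 u),
      (a.memLp_top (μ := volume)).coeFn_toLp, coeFn_mulOp a (𝓕 u)] with z h1 h2 h3
    rw [h1, h3, Pi.smul_apply', h2, smul_eq_mul]
  rw [h2] at h
  rw [TemperedDistribution.fourierMultiplierCLM_apply, Lp.fourier_toTemperedDistribution_eq, ← h,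
    Lp.fourierInv_toTemperedDistribution_eq, fm_apply]

lemma fm_toLp {a : ℝ →ᵇ ℂ} (ha : (a : ℝ → ℂ).HasTemperateGrowth) (u : 𝓢(ℝ, ℂ)) :
    fm a (u.toLp 2) = (SchwartzMap.fourierMultiplierCLM ℂ a u).toLp 2 := by
  apply toTempered_injective
  rw [fm_toTempered ha, Lp.toTemperedDistribution_toLp_eq, Lp.toTemperedDistribution_toLp_eq,
    fourierMultiplierCLM_toTemperedDistributionCLM_eq ha]

/-! ### The free resolvents and the space `H²(ℝ)` -/

/-- The symbol `(c + (2πξ)²)⁻¹` of the resolvent `(-∂² + c)⁻¹`. -/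
def rSym (c : ℝ) (hc : 0 < c) : ℝ →ᵇ ℂ :=
  .ofNormedAddCommGroup (fun ξ => (((c + (2 * Real.pi * ξ) ^ 2)⁻¹ : ℝ) : ℂ))
    (Complex.continuous_ofReal.comp ((by fun_prop : Continuous fun ξ : ℝ =>
      c + (2 * Real.pi * ξ) ^ 2).inv₀ fun ξ => by positivity)) c⁻¹ fun ξ => by
      rw [Complex.norm_real, Real.norm_of_nonneg (by positivity)]
      exact inv_anti₀ hc (by linarith [sq_nonneg (2 * Real.pi * ξ)])

/-- The symbol `(4 + (2πξ)²)^(-1/2)`. -/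
def jSym : ℝ →ᵇ ℂ :=
  .ofNormedAddCommGroup (fun ξ => (((√(4 + (2 * Real.pi * ξ) ^ 2))⁻¹ : ℝ) : ℂ))
    (Complex.continuous_ofReal.comp ((by fun_prop : Continuous fun ξ : ℝ =>
      √(4 + (2 * Real.pi * ξ) ^ 2)).inv₀ fun ξ => by positivity)) 1 fun ξ => by
      rw [Complex.norm_real, Real.norm_of_nonneg (by positivity)]
      exact inv_le_one_of_one_le₀ (Real.one_le_sqrt.2 (by linarith [sq_nonneg (2 * Real.pi * ξ)]))

/-- The symbol `2πiξ (4 + (2πξ)²)^(-1/2)`. -/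
def nSym : ℝ →ᵇ ℂ :=
  .ofNormedAddCommGroup (fun ξ => (2 * Real.pi * Complex.I) * ξ * jSym ξ)
    (by fun_prop) 1 fun ξ => by
      have h : ‖jSym ξ‖ = (√(4 + (2 * Real.pi * ξ) ^ 2))⁻¹ := by
        simp only [jSym, BoundedContinuousFunction.coe_ofNormedAddCommGroup]
        rw [Complex.norm_real, Real.norm_of_nonneg (by positivity)]
      rw [norm_mul, h, ← div_eq_mul_inv, div_le_one (by positivity)]
      refine Real.le_sqrt_of_sq_le ?_
      rw [← Complex.normSq_eq_norm_sq]
      simp [Complex.normSq_apply]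
      nlinarith

lemma rSym_apply (c : ℝ) (hc : 0 < c) (ξ : ℝ) :
    rSym c hc ξ = (((c + (2 * Real.pi * ξ) ^ 2)⁻¹ : ℝ) : ℂ) := rfl

lemma jSym_apply (ξ : ℝ) : jSym ξ = (((√(4 + (2 * Real.pi * ξ) ^ 2))⁻¹ : ℝ) : ℂ) := rfl

lemma nSym_apply (ξ : ℝ) : nSym ξ = (2 * Real.pi * Complex.I) * ξ * jSym ξ := rfl

lemma norm_rSym_le (c : ℝ) (hc : 0 < c) : ‖rSym c hc‖ ≤ c⁻¹ :=
  BoundedContinuousFunction.norm_ofNormedAddCommGroup_le _ (by positivity) _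

lemma star_rSym (c : ℝ) (hc : 0 < c) : star (rSym c hc) = rSym c hc := by
  ext ξ; simp [rSym_apply]

lemma star_jSym : star jSym = jSym := by
  ext ξ; simp [jSym_apply]

lemma jSym_mul_jSym : jSym * jSym = rSym 4 four_pos := by
  ext ξ
  rw [BoundedContinuousFunction.mul_apply, jSym_apply, rSym_apply, ← Complex.ofReal_mul,
    ← mul_inv, Real.mul_self_sqrt (by positivity)]

lemma rSym_four_mul (ξ : ℝ) : (4 + (2 * Real.pi * ξ : ℂ) ^ 2) * rSym 4 four_pos ξ = 1 := by
  rw [rSym_apply]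
  have : (4 + (2 * Real.pi * ξ) ^ 2 : ℝ) ≠ 0 := by positivity
  have h2 : (4 + (2 * Real.pi * ξ : ℂ) ^ 2) ≠ 0 := by exact_mod_cast this
  push_cast
  exact mul_inv_cancel₀ h2

lemma star_nSym_mul_nSym : star nSym * nSym = 1 - (4 : ℂ) • rSym 4 four_pos := by
  ext ξ
  have h := rSym_four_mul ξ
  rw [← jSym_mul_jSym] at h
  have hj : (starRingEnd ℂ) (jSym ξ) = jSym ξ := by simp [jSym_apply]
  simp only [BoundedContinuousFunction.mul_apply, BoundedContinuousFunction.star_apply, nSym_apply,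
    BoundedContinuousFunction.sub_apply, BoundedContinuousFunction.smul_apply,
    BoundedContinuousFunction.coe_one, Pi.one_apply, ← jSym_mul_jSym, RCLike.star_def, map_mul, hj,
    Complex.conj_I, Complex.conj_ofReal, smul_eq_mul, map_ofNat] at h ⊢
  linear_combination h - jSym ξ ^ 2 * (2 * Real.pi * ξ) ^ 2 * Complex.I_sq

/-- The resolvent identity for the free resolvents. -/
lemma rSym_sub_rSym (c d : ℝ) (hc : 0 < c) (hd : 0 < d) :
    rSym c hc = rSym d hd + ((d - c : ℝ) : ℂ) • (rSym c hc * rSym d hd) := by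
  ext ξ
  simp only [BoundedContinuousFunction.mul_apply, BoundedContinuousFunction.add_apply,
    BoundedContinuousFunction.smul_apply, rSym_apply, smul_eq_mul]
  norm_cast
  have h1 : (c + (2 * Real.pi * ξ) ^ 2 : ℝ) ≠ 0 := by positivity
  have h2 : (d + (2 * Real.pi * ξ) ^ 2 : ℝ) ≠ 0 := by positivity
  field_simp
  ring

lemma jSym_hasTemperateGrowth : (jSym : ℝ → ℂ).HasTemperateGrowth := by
  have h : (jSym : ℝ → ℂ) = fun ξ : ℝ =>
      (((1 / 2 : ℝ) * (1 + ‖Real.pi * ξ‖ ^ 2) ^ (-1 / 2 : ℝ) : ℝ) : ℂ) := by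
    funext ξ
    rw [jSym_apply]
    congr 1
    rw [Real.norm_eq_abs, sq_abs, show (-1 / 2 : ℝ) = -(1 / 2) by norm_num,
      Real.rpow_neg (by positivity), ← Real.sqrt_eq_rpow,
      show 4 + (2 * Real.pi * ξ) ^ 2 = 2 ^ 2 * (1 + (Real.pi * ξ) ^ 2) by ring,
      Real.sqrt_mul (by positivity), Real.sqrt_sq (by norm_num), mul_inv]
    norm_num
  rw [h]
  have h1 : Function.HasTemperateGrowth fun ξ : ℝ => (1 + ‖Real.pi * ξ‖ ^ 2) ^ (-1 / 2 : ℝ) :=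
    Function.HasTemperateGrowth.comp (g := fun ξ : ℝ => (1 + ‖ξ‖ ^ 2) ^ (-1 / 2 : ℝ))
      (Function.hasTemperateGrowth_one_add_norm_sq_rpow ℝ (-1 / 2))
      (f := fun ξ : ℝ => Real.pi * ξ) (by fun_prop)
  have h2 : Function.HasTemperateGrowth fun ξ : ℝ => (1 / 2 : ℝ) * (1 + ‖Real.pi * ξ‖ ^ 2) ^ (-1 / 2 : ℝ) := by
    fun_prop
  exact Function.HasTemperateGrowth.comp Function.Complex.hasTemperateGrowth_ofReal h2

lemma nSym_hasTemperateGrowth : (nSym : ℝ → ℂ).HasTemperateGrowth := by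
  have := jSym_hasTemperateGrowth
  have h : (nSym : ℝ → ℂ) = fun ξ : ℝ => (2 * Real.pi * Complex.I) * (ξ : ℂ) * jSym ξ := rfl
  rw [h]
  fun_prop

lemma rSym_four_hasTemperateGrowth : (rSym 4 four_pos : ℝ → ℂ).HasTemperateGrowth := by
  rw [← jSym_mul_jSym, BoundedContinuousFunction.coe_mul]
  exact jSym_hasTemperateGrowth.mul jSym_hasTemperateGrowth

/-- The free resolvent `(-∂² + c)⁻¹` on `L²(ℝ)`. -/
def res (c : ℝ) (hc : 0 < c) : L2 →L[ℂ] L2 := fm (rSym c hc)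

/-- The operator `(-∂² + 4)^(-1/2)` on `L²(ℝ)`; its square has range `H²(ℝ)`. -/
def opJ : L2 →L[ℂ] L2 := fm jSym

/-- The bounded operator `∂ (-∂² + 4)^(-1/2)` on `L²(ℝ)`. -/
def opN : L2 →L[ℂ] L2 := fm nSym

lemma opJ_opJ (u : L2) : opJ (opJ u) = res 4 four_pos u := by
  rw [opJ, res, ← fm_mul, jSym_mul_jSym]

lemma inner_opJ (u v : L2) : ⟪opJ u, v⟫_ℂ = ⟪u, opJ v⟫_ℂ := by
  rw [opJ, inner_fm, star_jSym]

lemma inner_res (c : ℝ) (hc : 0 < c) (u v : L2) : ⟪res c hc u, v⟫_ℂ = ⟪u, res c hc v⟫_ℂ := by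
  rw [res, inner_fm, star_rSym]

lemma inner_opN_opN (u : L2) : ⟪opN u, opN u⟫_ℂ = ⟪u, u⟫_ℂ - 4 * ⟪opJ u, opJ u⟫_ℂ := by
  rw [inner_opJ, opJ_opJ, opN, inner_fm, ← fm_mul, star_nSym_mul_nSym, sub_eq_add_neg, ← neg_smul,
    fm_add, fm_one, fm_smul, inner_add_right, inner_smul_right]
  simp only [res]; ring

lemma res_eq (c d : ℝ) (hc : 0 < c) (hd : 0 < d) (u : L2) :
    res c hc u = res d hd u + ((d - c : ℝ) : ℂ) • res c hc (res d hd u) := by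
  conv_lhs => rw [res, rSym_sub_rSym c d hc hd]
  rw [fm_add, fm_smul, fm_mul]; rfl

lemma norm_res_le (c : ℝ) (hc : 0 < c) (u : L2) : ‖res c hc u‖ ≤ c⁻¹ * ‖u‖ :=
  ((res c hc).le_opNorm u).trans (mul_le_mul_of_nonneg_right
    ((norm_fm_le _).trans (norm_rSym_le c hc)) (norm_nonneg _))

lemma lineDeriv_toTempered_eq (T : 𝓢'(ℝ, ℂ)) :
    ∂_{(1 : ℝ)} (∂_{(1 : ℝ)} T) = fourierMultiplierCLM ℂ (fun ξ : ℝ => -(2 * Real.pi * ξ : ℂ) ^ 2) T := by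
  rw [TemperedDistribution.lineDeriv_eq_fourierMultiplierCLM,
    TemperedDistribution.lineDeriv_eq_fourierMultiplierCLM, ContinuousLinearMap.map_smul,
    fourierMultiplierCLM_fourierMultiplierCLM_apply (by fun_prop) (by fun_prop), smul_smul,
    ← smul_apply, ← fourierMultiplierCLM_smul (by fun_prop)]
  congr 2
  funext ξ
  simp only [Pi.smul_apply, Pi.mul_apply, smul_eq_mul, RCLike.inner_apply, one_mul,
    conj_trivial]
  linear_combination (4 * Real.pi ^ 2 * ξ ^ 2 : ℂ) * Complex.I_sq

lemma res_four_mem_H2 (h : L2) : res 4 four_pos h ∈ H2 := by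
  set b : ℝ →ᵇ ℂ := ((1 / (4 * Real.pi ^ 2) : ℝ) : ℂ) •
    (1 + ((4 * Real.pi ^ 2 - 4 : ℝ) : ℂ) • rSym 4 four_pos) with hb
  refine ⟨fm b h, ?_⟩
  have e : (rSym 4 four_pos : ℝ → ℂ) * (fun x : ℝ => (((1 + ‖x‖ ^ 2) ^ ((2 : ℝ) / 2) : ℝ) : ℂ)) = b := by
    funext ξ
    simp only [hb, Pi.mul_apply, BoundedContinuousFunction.add_apply,
      BoundedContinuousFunction.smul_apply, BoundedContinuousFunction.coe_one, Pi.one_apply,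
      smul_eq_mul, rSym_apply, Real.norm_eq_abs, sq_abs, div_self (two_ne_zero' ℝ), Real.rpow_one]
    have h1 : (4 + (2 * Real.pi * ξ) ^ 2 : ℝ) ≠ 0 := by positivity
    have h2 := Real.pi_ne_zero
    norm_cast
    field_simp
    ring
  have ht : (b : ℝ → ℂ).HasTemperateGrowth := by
    rw [← e]
    exact rSym_four_hasTemperateGrowth.mul (by fun_prop)
  rw [besselPotential, fm_toTempered ht, res, fm_toTempered rSym_four_hasTemperateGrowth,
    fourierMultiplierCLM_fourierMultiplierCLM_apply rSym_four_hasTemperateGrowth (by fun_prop), e]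

lemma exists_res_four {u : L2} (hu : u ∈ H2) : ∃ h, u = res 4 four_pos h := by
  obtain ⟨f, hf⟩ : MemSobolev 2 2 (u : 𝓢'(ℝ, ℂ)) := hu
  have hp : 0 < 4 * Real.pi ^ 2 := by positivity
  set a : ℝ →ᵇ ℂ := ((4 * Real.pi ^ 2 : ℝ) : ℂ) •
    (1 + ((4 - 4 * Real.pi ^ 2 : ℝ) : ℂ) • rSym _ hp) with ha
  refine ⟨fm a f, ?_⟩
  have e : (((rSym 4 four_pos * a : ℝ →ᵇ ℂ)) : ℝ → ℂ) =
      fun x : ℝ => (((1 + ‖x‖ ^ 2) ^ (-(2 : ℝ) / 2) : ℝ) : ℂ) := by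
    funext ξ
    simp only [ha, BoundedContinuousFunction.mul_apply, BoundedContinuousFunction.add_apply,
      BoundedContinuousFunction.smul_apply, BoundedContinuousFunction.coe_one, Pi.one_apply,
      smul_eq_mul, rSym_apply, Real.norm_eq_abs, sq_abs, neg_div, div_self (two_ne_zero' ℝ),
      Real.rpow_neg_one]
    have h1 : (4 + (2 * Real.pi * ξ) ^ 2 : ℝ) ≠ 0 := by positivity
    have h3 : (4 * Real.pi ^ 2 + (2 * Real.pi * ξ) ^ 2 : ℝ) ≠ 0 := by positivity
    have h4 : (1 + ξ ^ 2 : ℝ) ≠ 0 := by positivity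
    have h2 := Real.pi_ne_zero
    norm_cast
    rw [show 4 * Real.pi ^ 2 + (2 * Real.pi * ξ) ^ 2 = 4 * Real.pi ^ 2 * (1 + ξ ^ 2) by ring]
    field_simp
    ring
  have ht : ((rSym 4 four_pos * a : ℝ →ᵇ ℂ) : ℝ → ℂ).HasTemperateGrowth := by
    rw [e]
    exact Function.HasTemperateGrowth.comp Function.Complex.hasTemperateGrowth_ofReal
      (Function.hasTemperateGrowth_one_add_norm_sq_rpow ℝ _)
  apply toTempered_injective
  rw [res, ← fm_mul, fm_toTempered ht, e]
  exact ((besselPotential_neg_apply_eq_iff 2 _ _).2 hf).symm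

lemma secondDeriv_res (h : L2) (hh : res 4 four_pos h ∈ H2) :
    secondDeriv ⟨res 4 four_pos h, hh⟩ = (4 : ℂ) • res 4 four_pos h - h := by
  apply toTempered_injective
  have h1 : ((secondDeriv ⟨res 4 four_pos h, hh⟩ : L2) : 𝓢'(ℝ, ℂ)) = _ :=
    (exists_secondDeriv ⟨res 4 four_pos h, hh⟩).choose_spec
  rw [h1, lineDeriv_toTempered_eq]
  simp only [res]
  rw [fm_toTempered rSym_four_hasTemperateGrowth,
    fourierMultiplierCLM_fourierMultiplierCLM_apply rSym_four_hasTemperateGrowth (by fun_prop)]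
  have e : (rSym 4 four_pos : ℝ → ℂ) * (fun ξ : ℝ => -(2 * Real.pi * ξ : ℂ) ^ 2) =
      ((4 : ℂ) • rSym 4 four_pos - 1 : ℝ →ᵇ ℂ) := by
    funext ξ
    have h := rSym_four_mul ξ
    simp only [Pi.mul_apply, BoundedContinuousFunction.sub_apply, BoundedContinuousFunction.smul_apply,
      BoundedContinuousFunction.coe_one, Pi.one_apply, smul_eq_mul]
    linear_combination -h
  have ht : (((4 : ℂ) • rSym 4 four_pos - 1 : ℝ →ᵇ ℂ) : ℝ → ℂ).HasTemperateGrowth := by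
    rw [← e]
    exact rSym_four_hasTemperateGrowth.mul (by fun_prop)
  rw [e, ← fm_toTempered ht]
  congr 1
  rw [sub_eq_add_neg, fm_add, fm_smul, ← neg_one_smul ℂ (1 : ℝ →ᵇ ℂ), fm_smul, fm_one, neg_one_smul,
    sub_eq_add_neg]

/-! ### Compactness of `ψ(-∂² + 4)^(-1/2)` -/

/-- `L²` convergence implies convergence almost everywhere along a subsequence. -/
lemma exists_subseq_tendsto_ae {f : ℕ → L2} {g : L2} (h : Tendsto f atTop (𝓝 g)) :
    ∃ ns : ℕ → ℕ, StrictMono ns ∧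
      ∀ᵐ x, Tendsto (fun i => (f (ns i) : ℝ → ℂ) x) atTop (𝓝 ((g : ℝ → ℂ) x)) :=
  (tendstoInMeasure_of_tendsto_Lp h).exists_seq_tendsto_ae

/-- Approximation of an `L²` function by Schwartz functions. -/
lemma exists_schwartz_tendsto (g : L2) :
    ∃ p : ℕ → 𝓢(ℝ, ℂ), Tendsto (fun n => (p n).toLp 2) atTop (𝓝 g) := by
  have hd : DenseRange (SchwartzMap.toLpCLM ℂ (E := ℝ) ℂ 2 (volume : Measure ℝ)) :=
    SchwartzMap.denseRange_toLpCLM ENNReal.ofNat_ne_top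
  obtain ⟨x, hx, hl⟩ := mem_closure_iff_seq_limit.1 (hd.closure_eq ▸ Set.mem_univ g :
    g ∈ closure (Set.range (SchwartzMap.toLpCLM ℂ (E := ℝ) ℂ 2 (volume : Measure ℝ))))
  choose p hp using hx
  refine ⟨p, ?_⟩
  convert hl using 2 with n
  exact hp n

/-- A Hilbert–Schmidt criterion for compactness: summability over an orthonormal basis. -/
lemma isCompactOperator_of_sum_le {H G : Type*} [NormedAddCommGroup H] [InnerProductSpace ℂ H]
    [CompleteSpace H] [NormedAddCommGroup G] [InnerProductSpace ℂ G] [CompleteSpace G]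
    (T : H →L[ℂ] G) {ι : Type*} (b : HilbertBasis ι ℂ H) (C : ℝ)
    (h : ∀ s : Finset ι, ∑ i ∈ s, ‖T (b i)‖ ^ 2 ≤ C) : IsCompactOperator T := by
  classical
  have hs : Summable fun i => ‖T (b i)‖ ^ 2 :=
    summable_of_sum_le (fun i => by positivity) h
  set P : Finset ι → (H →L[ℂ] G) := fun s => ∑ i ∈ s, (innerSL ℂ (b i)).smulRight (T (b i)) with hP
  have hPf : ∀ s f, P s f = ∑ i ∈ s, ⟪b i, f⟫_ℂ • T (b i) := fun s f => by
    simp [hP]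
  refine isCompactOperator_of_tendsto (l := (atTop : Filter (Finset ι))) (F := P) ?_ ?_
  · rw [Metric.tendsto_atTop]
    intro ε hε
    obtain ⟨s, hs2⟩ := (summable_iff_vanishing_norm.1 hs) ((ε / 2) ^ 2) (by positivity)
    refine ⟨s, fun t hst => ?_⟩
    rw [dist_eq_norm]
    refine lt_of_le_of_lt (ContinuousLinearMap.opNorm_le_bound _ (half_pos hε).le fun f => ?_)
      (half_lt_self hε)
    have hlim : Tendsto (fun u : Finset ι => P t f - P u f) atTop (𝓝 (P t f - T f)) := by
      refine tendsto_const_nhds.sub ?_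
      have h1 : HasSum (fun i => T (b.repr f i • b i)) (T f) := T.hasSum (b.hasSum_repr f)
      simp only [map_smul, b.repr_apply_apply] at h1
      simpa only [hPf, HasSum, SummationFilter.unconditional_filter] using h1
    refine le_of_tendsto hlim.norm ?_
    filter_upwards [eventually_ge_atTop t] with u hu
    rw [norm_sub_rev, hPf, hPf, ← Finset.sum_sdiff hu, add_sub_cancel_right]
    refine (norm_sum_le _ _).trans ?_
    simp only [norm_smul]
    refine (Real.sum_mul_le_sqrt_mul_sqrt _ _ _).trans ?_
    rw [mul_comm]
    refine mul_le_mul (Real.sqrt_le_iff.2 ⟨by positivity, ?_⟩) (Real.sqrt_le_iff.2 ⟨norm_nonneg _, ?_⟩)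
      (Real.sqrt_nonneg _) (by positivity)
    · have := hs2 (u \ t) (Finset.disjoint_of_subset_right hst Finset.sdiff_disjoint)
      rw [Real.norm_of_nonneg (Finset.sum_nonneg fun i _ => by positivity)] at this
      exact this.le
    · exact b.orthonormal.sum_inner_products_le f
  · refine Eventually.of_forall fun s => ?_
    refine Finset.sum_induction _ (fun A : H →L[ℂ] G => IsCompactOperator A)
      (fun A B hA hB => hA.add hB) isCompactOperator_zero fun i _ => ?_
    exact (isCompactOperator_of_locallyCompactSpace_dom (innerSL ℂ (b i))).clm_comp
      (ContinuousLinearMap.toSpanSingleton ℂ (T (b i)))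

/-- An operator given by a kernel `k` with `x ↦ ‖k x‖` dominated in `L²` is compact. -/
lemma isCompactOperator_of_kernel {H : Type*} [NormedAddCommGroup H] [InnerProductSpace ℂ H]
    [CompleteSpace H] (T : H →L[ℂ] L2) (k : ℝ → H) (m : ℝ → ℝ) (hm : Integrable fun x => m x ^ 2)
    (hk : ∀ x, ‖k x‖ ≤ m x) (hT : ∀ f, T f =ᵐ[volume] fun x => ⟪k x, f⟫_ℂ) :
    IsCompactOperator T := by
  obtain ⟨w, b, hb⟩ := exists_hilbertBasis ℂ H
  refine isCompactOperator_of_sum_le T b (∫ x, m x ^ 2) fun s => ?_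
  have hint : ∀ f : L2, Integrable fun x => ‖f x‖ ^ 2 := fun f =>
    (memLp_two_iff_integrable_sq_norm (Lp.aestronglyMeasurable f)).1 (Lp.memLp f)
  have hnorm : ∀ f : L2, ‖f‖ ^ 2 = ∫ x, ‖f x‖ ^ 2 := fun f => by
    have := L2.inner_def (𝕜 := ℂ) f f
    simp only [inner_self_eq_norm_sq_to_K] at this
    norm_cast at this
  simp_rw [hnorm]
  rw [← integral_finsetSum _ fun i _ => hint _]
  refine integral_mono_ae (integrable_finsetSum _ fun i _ => hint _) hm ?_
  have : ∀ᵐ x, ∀ i ∈ s, T (b i) x = ⟪k x, b i⟫_ℂ :=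
    (ae_ball_iff s.countable_toSet).2 fun i _ => hT (b i)
  filter_upwards [this] with x hx
  rw [Finset.sum_congr rfl fun i hi => by rw [hx i hi, norm_inner_symm]]
  exact (b.orthonormal.sum_inner_products_le (k x)).trans
    (pow_le_pow_left₀ (norm_nonneg _) (hk x) 2)

lemma norm_jSym_sq (ξ : ℝ) : ‖jSym ξ‖ ^ 2 = (4 + (2 * Real.pi * ξ) ^ 2)⁻¹ := by
  rw [jSym_apply, Complex.norm_real, Real.norm_of_nonneg (by positivity), inv_pow,
    Real.sq_sqrt (by positivity)]

lemma jSym_memLp : MemLp jSym 2 := by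
  rw [memLp_two_iff_integrable_sq_norm jSym.continuous.aestronglyMeasurable]
  refine integrable_inv_one_add_sq.mono' (by fun_prop) (Eventually.of_forall fun ξ => ?_)
  rw [norm_jSym_sq, Real.norm_of_nonneg (by positivity)]
  refine inv_anti₀ (by positivity) ?_
  nlinarith [sq_nonneg ξ, Real.pi_gt_three, mul_nonneg (sq_nonneg ξ) (by nlinarith [Real.pi_gt_three] : 0 ≤ 4 * Real.pi ^ 2 - 1)]

lemma jKer_memLp (x : ℝ) :
    MemLp (fun ξ : ℝ => Complex.exp (((-2 * Real.pi * ξ * x : ℝ) : ℂ) * Complex.I) * jSym ξ) 2 :=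
  jSym_memLp.of_le ((Complex.continuous_exp.comp ((Complex.continuous_ofReal.comp
    ((continuous_const.mul continuous_id).mul continuous_const)).mul continuous_const)).mul
      jSym.continuous).aestronglyMeasurable (Eventually.of_forall fun ξ => by
    rw [norm_mul, Complex.norm_exp_ofReal_mul_I, one_mul])

/-- The Fourier transform of the integral kernel of `(-∂² + 4)^(-1/2)`. -/
def jKer (x : ℝ) : L2 := (jKer_memLp x).toLp _

lemma norm_jKer (x : ℝ) : ‖jKer x‖ = ‖jSym_memLp.toLp _‖ := by
  rw [jKer, Lp.norm_toLp, Lp.norm_toLp]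
  congr 1
  refine eLpNorm_congr_norm_ae (Eventually.of_forall fun ξ => ?_)
  rw [norm_mul, Complex.norm_exp_ofReal_mul_I, one_mul]

lemma opJ_toLp (p : 𝓢(ℝ, ℂ)) (x : ℝ) :
    SchwartzMap.fourierMultiplierCLM ℂ jSym p x = ⟪jKer x, 𝓕 (p.toLp 2)⟫_ℂ := by
  rw [SchwartzMap.fourierMultiplierCLM_apply, SchwartzMap.toLp_fourier_eq, L2.inner_def,
    SchwartzMap.fourierInv_coe, Real.fourierInv_eq']
  refine integral_congr_ae ?_
  filter_upwards [(jKer_memLp x).coeFn_toLp, (𝓕 p).coeFn_toLp 2] with ξ h1 h2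
  have hconj : (starRingEnd ℂ) (jSym ξ) = jSym ξ := by rw [jSym_apply]; simp
  have hexp : (starRingEnd ℂ) (Complex.exp (((-2 * Real.pi * ξ * x : ℝ) : ℂ) * Complex.I)) =
      Complex.exp (((2 * Real.pi * inner ℝ ξ x : ℝ) : ℂ) * Complex.I) := by
    rw [← Complex.exp_conj, map_mul, Complex.conj_ofReal, Complex.conj_I,
      show inner ℝ ξ x = x * ξ from rfl]
    congr 1
    push_cast
    ring
  rw [jKer, h1, h2, SchwartzMap.smulLeftCLM_apply_apply jSym_hasTemperateGrowth, ← hexp,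
    RCLike.inner_apply, map_mul, hconj, smul_eq_mul, smul_eq_mul]
  generalize 𝓕 p ξ = a
  ring

lemma coeFn_opJ (g : L2) : opJ g =ᵐ[volume] fun x => ⟪jKer x, 𝓕 g⟫_ℂ := by
  obtain ⟨p, hp⟩ := exists_schwartz_tendsto g
  obtain ⟨ns, hns, hae⟩ := exists_subseq_tendsto_ae ((opJ.continuous.tendsto g).comp hp)
  have h1 : ∀ᵐ x, ∀ n, opJ ((p n).toLp 2) x = ⟪jKer x, 𝓕 ((p n).toLp 2)⟫_ℂ := by
    rw [ae_all_iff]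
    intro n
    rw [opJ, fm_toLp jSym_hasTemperateGrowth]
    filter_upwards [SchwartzMap.coeFn_toLp (SchwartzMap.fourierMultiplierCLM ℂ jSym (p n)) 2] with x hx
    rw [hx, opJ_toLp]
  filter_upwards [hae, h1] with x hx h1
  refine tendsto_nhds_unique hx ?_
  simp only [Function.comp_apply, h1]
  have hc : Continuous fun u : L2 => ⟪jKer x, 𝓕 u⟫_ℂ :=
    continuous_const.inner (Lp.fourierTransformₗᵢ ℝ ℂ).continuous
  exact ((hc.tendsto g).comp hp).comp hns.tendsto_atTop

/-- `ψ` as a bounded continuous function. -/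
def psiB : ℝ →ᵇ ℂ :=
  .ofNormedAddCommGroup (fun z => (psi z : ℂ)) (Complex.continuous_ofReal.comp psi_continuous) 1
    fun z => by
      rw [Complex.norm_real, Real.norm_of_nonneg (psi_pos z).le]; exact psi_le_one z

lemma phi_hasDerivAt (z : ℝ) : HasDerivAt phi (psi z ^ 2) z := by
  have h : phi = fun x => Real.sinh x / Real.cosh x :=
    funext fun x => Real.tanh_eq_sinh_div_cosh x
  have hd : DifferentiableAt ℝ phi z := by
    rw [h]
    exact Real.differentiable_sinh.differentiableAt.div Real.differentiable_cosh.differentiableAt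
      (Real.cosh_pos z).ne'
  simpa only [deriv_phi] using hd.hasDerivAt

lemma phi_continuous : Continuous phi :=
  continuous_iff_continuousAt.2 fun z => (phi_hasDerivAt z).continuousAt

/-- `φ` as a bounded continuous function. -/
def phiB : ℝ →ᵇ ℂ :=
  .ofNormedAddCommGroup (fun z => (phi z : ℂ)) (Complex.continuous_ofReal.comp
    phi_continuous) 1
    fun z => by
      rw [Complex.norm_real]; exact (Real.abs_tanh_lt_one z).le

lemma psiB_apply (z : ℝ) : psiB z = (psi z : ℂ) := rfl

lemma phiB_apply (z : ℝ) : phiB z = (phi z : ℂ) := rfl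

/-- The operator `ψ (-∂² + 4)^(-1/2)` is Hilbert–Schmidt, hence compact. -/
lemma isCompactOperator_psi_opJ : IsCompactOperator (mulOp psiB ∘L opJ) := by
  refine isCompactOperator_of_kernel _
    (fun x => (psi x : ℂ) • (Lp.fourierTransformₗᵢ ℝ ℂ).symm (jKer x))
    (fun x => psi x * ‖jSym_memLp.toLp _‖) ?_ ?_ ?_
  · simp only [mul_pow]
    exact psi_integrable_sq.mul_const _
  · intro x
    rw [norm_smul, LinearIsometryEquiv.norm_map, norm_jKer, Complex.norm_real,
      Real.norm_of_nonneg (psi_pos x).le]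
  · intro f
    filter_upwards [coeFn_mulOp psiB (opJ f), coeFn_opJ f] with x h1 h2
    rw [ContinuousLinearMap.comp_apply, h1, h2, inner_smul_left, Complex.conj_ofReal, psiB_apply]
    congr 1
    exact ((Lp.fourierTransformₗᵢ ℝ ℂ).symm.inner_map_map (jKer x) (𝓕 f)).symm.trans
      (by rw [show (Lp.fourierTransformₗᵢ ℝ ℂ).symm (𝓕 f) = f from
        (Lp.fourierTransformₗᵢ ℝ ℂ).symm_apply_apply f])

/-! ### The Darboux factorization -/

lemma schwartz_hasDerivAt (p : 𝓢(ℝ, ℂ)) (x : ℝ) : HasDerivAt p (∂_{(1 : ℝ)} p x) x := by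
  have h := (p.differentiableAt (x := x)).hasDerivAt
  rwa [← SchwartzMap.derivCLM_apply ℂ p x, SchwartzMap.derivCLM_apply ℂ p x,
    show deriv p x = ∂_{(1 : ℝ)} p x by rw [SchwartzMap.lineDerivOp_apply_eq_fderiv, fderiv_eq_smul_deriv, one_smul]] at h

lemma lineDeriv_multiplier_jSym (q : 𝓢(ℝ, ℂ)) :
    ∂_{(1 : ℝ)} (SchwartzMap.fourierMultiplierCLM ℂ jSym q) = SchwartzMap.fourierMultiplierCLM ℂ nSym q := by
  rw [SchwartzMap.lineDeriv_eq_fourierMultiplierCLM,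
    ← SchwartzMap.fourierMultiplierCLM_ofReal ℂ (by fun_prop),
    SchwartzMap.fourierMultiplierCLM_fourierMultiplierCLM_apply (by fun_prop)
      jSym_hasTemperateGrowth,
    ← smul_apply, ← SchwartzMap.fourierMultiplierCLM_smul
      (by have := jSym_hasTemperateGrowth; fun_prop)]
  congr 2
  funext ξ
  simp only [nSym_apply, Pi.smul_apply, Pi.mul_apply, smul_eq_mul, RCLike.inner_apply, one_mul,
    conj_trivial]
  rw [show (RCLike.ofReal ξ : ℂ) = (ξ : ℂ) from rfl]
  ring

lemma opN_toLp (q : 𝓢(ℝ, ℂ)) :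
    opN (q.toLp 2) = (∂_{(1 : ℝ)} (SchwartzMap.fourierMultiplierCLM ℂ jSym q)).toLp 2 := by
  rw [opN, fm_toLp nSym_hasTemperateGrowth, lineDeriv_multiplier_jSym]

lemma opJ_toLp_eq (q : 𝓢(ℝ, ℂ)) :
    opJ (q.toLp 2) = (SchwartzMap.fourierMultiplierCLM ℂ jSym q).toLp 2 :=
  fm_toLp jSym_hasTemperateGrowth q

lemma cosh_pow_hasDerivAt (m : ℕ) (x : ℝ) :
    HasDerivAt (fun x => Real.cosh x ^ m) (m * phi x * Real.cosh x ^ m) x := by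
  have h := (Real.hasDerivAt_cosh x).fun_pow m
  refine h.congr_deriv ?_
  rw [phi, Real.tanh_eq_sinh_div_cosh]
  have hc := (Real.cosh_pos x).ne'
  rcases m with _ | m
  · simp
  · field_simp
    simp [pow_succ]
    ring

/-- The commutator identity `∂φ + φ∂`, in weak form on Schwartz functions. -/
lemma schwartz_inner_deriv_phi (p : 𝓢(ℝ, ℂ)) :
    ⟪(∂_{(1 : ℝ)} p).toLp 2, mulOp phiB (p.toLp 2)⟫_ℂ + ⟪mulOp phiB (p.toLp 2), (∂_{(1 : ℝ)} p).toLp 2⟫_ℂ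
      = -⟪mulOp psiB (p.toLp 2), mulOp psiB (p.toLp 2)⟫_ℂ := by
  have hp := p.coeFn_toLp 2 (μ := volume)
  have hd := (∂_{(1 : ℝ)} p).coeFn_toLp 2 (μ := volume)
  generalize (p.toLp 2 : L2) = P at *
  generalize ((∂_{(1 : ℝ)} p).toLp 2 : L2) = D at *
  have hphi := coeFn_mulOp phiB P
  have hpsi := coeFn_mulOp psiB P
  rw [eq_neg_iff_add_eq_zero, L2.inner_def, L2.inner_def, L2.inner_def,
    ← integral_add (L2.integrable_inner _ _) (L2.integrable_inner _ _),
    ← integral_add ((L2.integrable_inner _ _).add (L2.integrable_inner _ _)) (L2.integrable_inner _ _)]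
  set F : ℝ → ℂ := fun x => (phi x : ℂ) * ((starRingEnd ℂ) (p x) * p x) with hF
  set F' : ℝ → ℂ := fun x => ((psi x ^ 2 : ℝ) : ℂ) * ((starRingEnd ℂ) (p x) * p x) + (phi x : ℂ) *
    ((starRingEnd ℂ) (∂_{(1 : ℝ)} p x) * p x + (starRingEnd ℂ) (p x) * ∂_{(1 : ℝ)} p x) with hF'
  have e : (fun x => ⟪D x, mulOp phiB P x⟫_ℂ +
      ⟪mulOp phiB P x, D x⟫_ℂ +
      ⟪mulOp psiB P x, mulOp psiB P x⟫_ℂ) =ᵐ[volume] F' := by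
    filter_upwards [hp, hd, hphi, hpsi] with x h1 h2 h3 h4
    rw [h3, h4, h1, h2]
    simp only [RCLike.inner_apply, map_mul, phiB_apply, psiB_apply, Complex.conj_ofReal, hF']
    push_cast
    ring
  have e2 : (fun x => ⟪mulOp phiB P x, P x⟫_ℂ) =ᵐ[volume] F := by
    filter_upwards [hp, hphi] with x h1 h3
    rw [h3, h1]
    simp only [RCLike.inner_apply, map_mul, phiB_apply, Complex.conj_ofReal, hF]
    ring
  have i1 : Integrable F' := (((L2.integrable_inner (𝕜 := ℂ) D (mulOp phiB P)).add
    (L2.integrable_inner (mulOp phiB P) D)).add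
      (L2.integrable_inner (mulOp psiB P) (mulOp psiB P))).congr e
  have i2 : Integrable F := (L2.integrable_inner (𝕜 := ℂ) (mulOp phiB P) P).congr e2
  rw [integral_congr_ae e]
  refine integral_eq_zero_of_hasDerivAt_of_integrable (fun x => ?_) i1 i2
  have h1 := schwartz_hasDerivAt p x
  have h2 : HasDerivAt (fun x => (starRingEnd ℂ) (p x)) ((starRingEnd ℂ) (∂_{(1 : ℝ)} p x)) x :=
    h1.star
  exact (phi_hasDerivAt x).ofReal_comp.mul (h2.mul h1)

lemma inner_opN_phi (g : L2) :
    ⟪opN g, mulOp phiB (opJ g)⟫_ℂ + ⟪mulOp phiB (opJ g), opN g⟫_ℂ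
      = -⟪mulOp psiB (opJ g), mulOp psiB (opJ g)⟫_ℂ := by
  obtain ⟨q, hq⟩ := exists_schwartz_tendsto g
  have hJ (a : ℝ →ᵇ ℂ) : Continuous fun g : L2 => mulOp a (opJ g) :=
    (mulOp a).continuous.comp opJ.continuous
  have h1 : Continuous fun g : L2 =>
      ⟪opN g, mulOp phiB (opJ g)⟫_ℂ + ⟪mulOp phiB (opJ g), opN g⟫_ℂ :=
    (opN.continuous.inner (hJ phiB)).add ((hJ phiB).inner opN.continuous)
  have h2 : Continuous fun g : L2 => -⟪mulOp psiB (opJ g), mulOp psiB (opJ g)⟫_ℂ :=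
    ((hJ psiB).inner (hJ psiB)).neg
  refine tendsto_nhds_unique ((h1.tendsto g).comp hq) (((h2.tendsto g).comp hq).congr fun n => ?_)
  simp only [Function.comp_apply]
  rw [opN_toLp, opJ_toLp_eq, schwartz_inner_deriv_phi]

lemma phi_sq (z : ℝ) : phi z ^ 2 = 1 - psi z ^ 2 := by
  rw [phi, psi, Real.tanh_eq_sinh_div_cosh, inv_pow, div_pow, Real.sinh_sq]
  have := (Real.cosh_pos z).ne'
  field_simp

lemma norm_mulOp_phi_sq (u : L2) : ‖mulOp phiB u‖ ^ 2 = ‖u‖ ^ 2 - ‖mulOp psiB u‖ ^ 2 := by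
  have h : star phiB * phiB = 1 + (-1 : ℂ) • (star psiB * psiB) := by
    ext z
    simp [phiB_apply, psiB_apply]
    norm_cast
    linarith [phi_sq z]
  have h2 : ⟪mulOp phiB u, mulOp phiB u⟫_ℂ = ⟪u, u⟫_ℂ - ⟪mulOp psiB u, mulOp psiB u⟫_ℂ := by
    rw [inner_mulOp, ← mulOp_mul, inner_mulOp, ← mulOp_mul, h, mulOp_add, mulOp_one, mulOp_smul,
      inner_add_right, inner_smul_right]
    ring
  simp only [inner_self_eq_norm_sq_to_K] at h2
  exact_mod_cast h2

/-- **Factorization identity.** With `A = ∂ + mφ` one has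
`A*A = -∂² - m(m+1)ψ² + m²`; here in terms of `g = (-∂² + 4)^(1/2) u`. -/
lemma norm_darboux_sq (m : ℕ) (g : L2) :
    ‖opN g + (m : ℂ) • mulOp phiB (opJ g)‖ ^ 2 =
      ‖g‖ ^ 2 - (4 - m ^ 2) * ‖opJ g‖ ^ 2 - m * (m + 1) * ‖mulOp psiB (opJ g)‖ ^ 2 := by
  have h1 : ‖opN g‖ ^ 2 = ‖g‖ ^ 2 - 4 * ‖opJ g‖ ^ 2 := by
    have := inner_opN_opN g
    simp only [inner_self_eq_norm_sq_to_K, show ∀ r : ℝ, (RCLike.ofReal r : ℂ) = (r : ℂ) from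
      fun _ => rfl] at this
    exact_mod_cast this
  have h2 : 2 * RCLike.re ⟪opN g, mulOp phiB (opJ g)⟫_ℂ = -‖mulOp psiB (opJ g)‖ ^ 2 := by
    have := congrArg RCLike.re (inner_opN_phi g)
    rw [map_add, inner_re_symm (mulOp phiB (opJ g)), map_neg, inner_self_eq_norm_sq] at this
    linarith
  have h3 : RCLike.re ⟪opN g, (m : ℂ) • mulOp phiB (opJ g)⟫_ℂ
      = m * RCLike.re ⟪opN g, mulOp phiB (opJ g)⟫_ℂ := by
    rw [inner_smul_right]
    simp
  rw [norm_add_sq (𝕜 := ℂ), h3, norm_smul, mul_pow, norm_mulOp_phi_sq, h1, Complex.norm_natCast]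
  linear_combination (m : ℝ) * h2

lemma indicator_cosh_memLp (m : ℕ) (a b : ℝ) :
    MemLp (Set.indicator (Set.Ioc a b) fun x => ((Real.cosh x ^ m : ℝ) : ℂ)) 2 := by
  rw [memLp_indicator_iff_restrict measurableSet_Ioc]
  have hc : Continuous fun x => ((Real.cosh x ^ m : ℝ) : ℂ) := by
    have := Real.continuous_cosh
    fun_prop
  obtain ⟨C, hC⟩ := isCompact_Icc.exists_bound_of_continuousOn (hc.continuousOn (s := Set.Icc a b))
  refine MemLp.of_bound hc.aestronglyMeasurable C ?_
  filter_upwards [ae_restrict_mem measurableSet_Ioc] with x hx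
  exact hC x (Set.Ioc_subset_Icc_self hx)

lemma inner_indicator_cosh (m : ℕ) (a b : ℝ) (u : L2) :
    ⟪(indicator_cosh_memLp m a b).toLp _, u⟫_ℂ =
      ∫ x in Set.Ioc a b, ((Real.cosh x ^ m : ℝ) : ℂ) * u x := by
  rw [L2.inner_def, ← integral_indicator measurableSet_Ioc]
  refine integral_congr_ae ?_
  filter_upwards [(indicator_cosh_memLp m a b).coeFn_toLp] with x hx
  rw [hx]
  by_cases h : x ∈ Set.Ioc a b
  · simp only [RCLike.inner_apply, Set.indicator_of_mem h, Complex.conj_ofReal, mul_comm]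
  · simp [Set.indicator_of_notMem h]

/-- The increments of `cosh^m p` are controlled by the `L²` norm of `p' + mφp`. -/
lemma exists_inner_eq_cosh_mul_sub (m : ℕ) (x y : ℝ) : ∃ W : L2, ∀ p : 𝓢(ℝ, ℂ),
    ((Real.cosh x ^ m : ℝ) : ℂ) * p x - ((Real.cosh y ^ m : ℝ) : ℂ) * p y =
      ⟪W, (∂_{(1 : ℝ)} p).toLp 2 + (m : ℂ) • mulOp phiB (p.toLp 2)⟫_ℂ := by
  refine ⟨(indicator_cosh_memLp m y x).toLp _ - (indicator_cosh_memLp m x y).toLp _, fun p => ?_⟩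
  set F : ℝ → ℂ := fun t => ((Real.cosh t ^ m : ℝ) : ℂ) * (∂_{(1 : ℝ)} p t + m * (phi t * p t)) with hF
  have hFc : Continuous F := by
    have := Real.continuous_cosh
    have := phi_continuous
    have := p.continuous
    have := (∂_{(1 : ℝ)} p).continuous
    fun_prop
  have e : ∀ a b : ℝ, ∫ t in Set.Ioc a b, ((Real.cosh t ^ m : ℝ) : ℂ) *
      ((∂_{(1 : ℝ)} p).toLp 2 + (m : ℂ) • mulOp phiB (p.toLp 2) : L2) t = ∫ t in Set.Ioc a b, F t := by
    intro a b
    refine integral_congr_ae (ae_restrict_of_ae ?_)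
    filter_upwards [Lp.coeFn_add ((∂_{(1 : ℝ)} p).toLp 2) ((m : ℂ) • mulOp phiB (p.toLp 2)),
      Lp.coeFn_smul (m : ℂ) (mulOp phiB (p.toLp 2)), coeFn_mulOp phiB (p.toLp 2),
      p.coeFn_toLp 2, (∂_{(1 : ℝ)} p).coeFn_toLp 2] with t h1 h2 h3 h4 h5
    rw [h1, Pi.add_apply, h2, Pi.smul_apply, h3, h4, h5, phiB_apply, smul_eq_mul]
  rw [inner_sub_left, inner_indicator_cosh, inner_indicator_cosh, e, e]
  change _ = ∫ t in y..x, F t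
  refine (intervalIntegral.integral_eq_sub_of_hasDerivAt (f := fun t => ((Real.cosh t ^ m : ℝ) : ℂ) * p t)
    (fun t _ => ?_) (hFc.intervalIntegrable _ _)).symm
  refine ((cosh_pow_hasDerivAt m t).ofReal_comp.mul (schwartz_hasDerivAt p t)).congr_deriv ?_
  simp only [F]
  push_cast
  ring

/-- The kernel of `∂ + mφ` on `H¹(ℝ)` is spanned by `ψ^m`. -/
lemma exists_eq_psi_pow_of_darboux_eq_zero (m : ℕ) (g : L2)
    (h : opN g + (m : ℂ) • mulOp phiB (opJ g) = 0) :
    ∃ c : ℂ, opJ g =ᵐ[volume] fun x => c * ((psi x ^ m : ℝ) : ℂ) := by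
  obtain ⟨q, hq⟩ := exists_schwartz_tendsto g
  obtain ⟨ns, hns, hae⟩ := exists_subseq_tendsto_ae ((opJ.continuous.tendsto g).comp hq)
  set p : ℕ → 𝓢(ℝ, ℂ) := fun n => SchwartzMap.fourierMultiplierCLM ℂ jSym (q (ns n)) with hp
  have hlim : Tendsto (fun n => (∂_{(1 : ℝ)} (p n)).toLp 2 volume + (m : ℂ) • mulOp phiB ((p n).toLp 2))
      atTop (𝓝 0) := by
    rw [← h]
    have hc : Continuous fun g => opN g + (m : ℂ) • mulOp phiB (opJ g) :=
      (opN + (m : ℂ) • (mulOp phiB ∘L opJ)).continuous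
    refine (((hc.tendsto g).comp hq).comp hns.tendsto_atTop).congr fun n => ?_
    simp only [Function.comp_apply, opN_toLp, opJ_toLp_eq, hp]
  have hptw : ∀ᵐ x, Tendsto (fun n => p n x) atTop (𝓝 (opJ g x)) := by
    have h1 : ∀ᵐ x, ∀ n, (opJ ((q (ns n)).toLp 2) : ℝ → ℂ) x = p n x := by
      rw [ae_all_iff]
      intro n
      rw [opJ_toLp_eq]
      exact SchwartzMap.coeFn_toLp _ 2 volume
    filter_upwards [hae, h1] with x hx h1
    exact hx.congr h1
  obtain ⟨y, hy⟩ := hptw.exists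
  refine ⟨((Real.cosh y ^ m : ℝ) : ℂ) * opJ g y, ?_⟩
  filter_upwards [hptw] with x hx
  obtain ⟨W, hW⟩ := exists_inner_eq_cosh_mul_sub m x y
  have h1 := (hx.const_mul ((Real.cosh x ^ m : ℝ) : ℂ)).sub (hy.const_mul ((Real.cosh y ^ m : ℝ) : ℂ))
  simp only [hW] at h1
  have h2 : Tendsto (fun n => ⟪W, (∂_{(1 : ℝ)} (p n)).toLp 2 volume +
      (m : ℂ) • mulOp phiB ((p n).toLp 2)⟫_ℂ) atTop (𝓝 0) := by
    simpa using (tendsto_const_nhds (x := W)).inner hlim (𝕜 := ℂ)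
  have h3 := sub_eq_zero.1 (tendsto_nhds_unique h1 h2)
  rw [← h3, psi, inv_pow]
  have hc : ((Real.cosh x ^ m : ℝ) : ℂ) ≠ 0 := by
    exact_mod_cast (pow_pos (Real.cosh_pos x) m).ne'
  push_cast at hc ⊢
  field_simp

/-! ### Classical `C²` functions in `H²(ℝ)` -/

lemma nSym_mul_nSym : nSym * nSym = (4 : ℂ) • rSym 4 four_pos + (-1 : ℂ) • 1 := by
  have h : star nSym = (-1 : ℂ) • nSym := by
    ext ξ
    simp [nSym_apply, jSym_apply]
  have h2 := star_nSym_mul_nSym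
  rw [h] at h2
  ext ξ
  have h3 := DFunLike.congr_fun h2 ξ
  simp only [BoundedContinuousFunction.mul_apply, BoundedContinuousFunction.add_apply,
    BoundedContinuousFunction.sub_apply, BoundedContinuousFunction.smul_apply,
    BoundedContinuousFunction.coe_one, Pi.one_apply, smul_eq_mul] at h3 ⊢
  linear_combination -h3

/-- Preimages of Schwartz functions under `-∂² + 4` are Schwartz functions. -/
lemma exists_schwartz_res (q : 𝓢(ℝ, ℂ)) : ∃ Q : 𝓢(ℝ, ℂ), Q.toLp 2 volume = res 4 four_pos (q.toLp 2 volume) ∧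
    (∂_{(1 : ℝ)} (∂_{(1 : ℝ)} Q)).toLp 2 volume = (4 : ℂ) • Q.toLp 2 volume - q.toLp 2 volume := by
  have hj := jSym_hasTemperateGrowth
  have hn := nSym_hasTemperateGrowth
  have h1 : (SchwartzMap.fourierMultiplierCLM ℂ jSym (SchwartzMap.fourierMultiplierCLM ℂ jSym q)).toLp 2 volume
      = res 4 four_pos (q.toLp 2 volume) := by
    rw [← fm_toLp hj, ← fm_toLp hj, ← fm_mul, jSym_mul_jSym, res]
  refine ⟨_, h1, ?_⟩
  rw [h1, lineDeriv_multiplier_jSym, SchwartzMap.fourierMultiplierCLM_fourierMultiplierCLM_apply hn hj,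
    mul_comm, ← SchwartzMap.fourierMultiplierCLM_fourierMultiplierCLM_apply hj hn,
    lineDeriv_multiplier_jSym, ← fm_toLp hn, ← fm_toLp hn, ← fm_mul, nSym_mul_nSym, fm_add, fm_smul,
    fm_smul, fm_one, res, neg_one_smul, sub_eq_add_neg]

/-- A `C²` function with `u, u', u''` in `L²` is `(-∂² + 4)⁻¹ (4u - u'')`, in particular it lies in
`H²(ℝ)`. -/
lemma toLp_eq_res {u u' u'' : ℝ → ℂ} (h1 : ∀ x, HasDerivAt u (u' x) x)
    (h2 : ∀ x, HasDerivAt u' (u'' x) x) (hu : MemLp u 2 volume) (hu' : MemLp u' 2 volume)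
    (hu'' : MemLp u'' 2 volume) :
    hu.toLp u = res 4 four_pos ((4 : ℂ) • hu.toLp u - hu''.toLp u'') := by
  have key : ∀ q : 𝓢(ℝ, ℂ), ⟪hu.toLp u, q.toLp 2 volume⟫_ℂ =
      ⟪res 4 four_pos ((4 : ℂ) • hu.toLp u - hu''.toLp u''), q.toLp 2 volume⟫_ℂ := by
    intro q
    obtain ⟨Q, hQ, hQ2⟩ := exists_schwartz_res q
    have hz : ⟪hu''.toLp u'', Q.toLp 2 volume⟫_ℂ = ⟪hu.toLp u, (∂_{(1 : ℝ)} (∂_{(1 : ℝ)} Q)).toLp 2 volume⟫_ℂ := by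
      have e0 := Q.coeFn_toLp 2 (μ := volume)
      have e1 := (∂_{(1 : ℝ)} Q).coeFn_toLp 2 (μ := volume)
      have e2 := (∂_{(1 : ℝ)} (∂_{(1 : ℝ)} Q)).coeFn_toLp 2 (μ := volume)
      have d0 := schwartz_hasDerivAt Q
      have d1 := schwartz_hasDerivAt (∂_{(1 : ℝ)} Q)
      generalize (Q.toLp 2 volume : L2) = A0 at *
      generalize ((∂_{(1 : ℝ)} Q).toLp 2 volume : L2) = A1 at *
      generalize ((∂_{(1 : ℝ)} (∂_{(1 : ℝ)} Q)).toLp 2 volume : L2) = A2 at *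
      generalize (∂_{(1 : ℝ)} (∂_{(1 : ℝ)} Q)) = Q2 at *
      generalize (∂_{(1 : ℝ)} Q) = Q1 at *
      rw [L2.inner_def, L2.inner_def, ← sub_eq_zero,
        ← integral_sub (L2.integrable_inner _ _) (L2.integrable_inner _ _)]
      set F : ℝ → ℂ := fun x => (starRingEnd ℂ) (u' x) * Q x - (starRingEnd ℂ) (u x) * Q1 x with hF
      set F' : ℝ → ℂ := fun x => (starRingEnd ℂ) (u'' x) * Q x - (starRingEnd ℂ) (u x) * Q2 x with hF'
      have E1 : (fun x => ⟪hu''.toLp u'' x, A0 x⟫_ℂ - ⟪hu.toLp u x, A2 x⟫_ℂ) =ᵐ[volume] F' := by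
        filter_upwards [e0, e2, hu.coeFn_toLp, hu''.coeFn_toLp] with x a0 a2 b0 b2
        rw [a0, a2, b0, b2]
        simp only [RCLike.inner_apply, hF']
        ring
      have E2 : (fun x => ⟪hu'.toLp u' x, A0 x⟫_ℂ - ⟪hu.toLp u x, A1 x⟫_ℂ) =ᵐ[volume] F := by
        filter_upwards [e0, e1, hu.coeFn_toLp, hu'.coeFn_toLp] with x a0 a2 b0 b2
        rw [a0, a2, b0, b2]
        simp only [RCLike.inner_apply, hF]
        ring
      have i1 : Integrable F' := ((L2.integrable_inner (𝕜 := ℂ) (hu''.toLp u'') A0).sub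
        (L2.integrable_inner (hu.toLp u) A2)).congr E1
      have i2 : Integrable F := ((L2.integrable_inner (𝕜 := ℂ) (hu'.toLp u') A0).sub
        (L2.integrable_inner (hu.toLp u) A1)).congr E2
      rw [integral_congr_ae E1]
      refine integral_eq_zero_of_hasDerivAt_of_integrable (fun x => ?_) i1 i2
      have c0 : HasDerivAt (fun x => (starRingEnd ℂ) (u x)) ((starRingEnd ℂ) (u' x)) x := (h1 x).star
      have c1 : HasDerivAt (fun x => (starRingEnd ℂ) (u' x)) ((starRingEnd ℂ) (u'' x)) x :=
        (h2 x).star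
      refine ((c1.mul (d0 x)).sub (c0.mul (d1 x))).congr_deriv ?_
      simp only [hF']
      ring
    rw [inner_res, ← hQ, inner_sub_left, hz, hQ2, inner_sub_right, inner_smul_left, inner_smul_right,
      map_ofNat]
    ring
  rw [← sub_eq_zero, ← inner_self_eq_zero (𝕜 := ℂ)]
  generalize hX : hu.toLp u - res 4 four_pos ((4 : ℂ) • hu.toLp u - hu''.toLp u'') = X
  have hk : ∀ q : 𝓢(ℝ, ℂ), ⟪X, q.toLp 2 volume⟫_ℂ = 0 := fun q => by
    rw [← hX, inner_sub_left, key, sub_self]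
  obtain ⟨q, hq⟩ := exists_schwartz_tendsto X
  have := (tendsto_const_nhds (x := X)).inner hq (𝕜 := ℂ)
  simp only [hk] at this
  exact tendsto_nhds_unique this tendsto_const_nhds |>.symm ▸ rfl

/-! ### The functions `ψ^s` and `φψ^s` -/

lemma psi_rpow_le {s : ℝ} (hs : 0 < s) (x : ℝ) :
    psi x ^ s ≤ 2 ^ s * (1 + 2 / s ^ 2) * (1 + x ^ 2)⁻¹ := by
  have h1 : Real.exp |x| / 2 ≤ Real.cosh x := by
    rw [← Real.cosh_abs, Real.cosh_eq]
    linarith [Real.exp_pos (-|x|)]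
  have h2 : 1 + x ^ 2 ≤ (1 + 2 / s ^ 2) * (2 ^ s * Real.cosh x ^ s) := by
    have h3 : 1 + s ^ 2 * x ^ 2 / 2 ≤ 2 ^ s * Real.cosh x ^ s := by
      rw [← Real.mul_rpow (by norm_num) (Real.cosh_pos x).le]
      calc 1 + s ^ 2 * x ^ 2 / 2 ≤ Real.exp (|x| * s) := by
            have h0 := Real.quadratic_le_exp_of_nonneg (x := |x| * s) (by positivity)
            have h4 : (|x| * s) ^ 2 = s ^ 2 * x ^ 2 := by rw [mul_pow, sq_abs, mul_comm]
            have h5 : 0 ≤ |x| * s := by positivity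
            linarith
        _ = Real.exp |x| ^ s := Real.exp_mul _ _
        _ ≤ _ := Real.rpow_le_rpow (Real.exp_pos _).le (by linarith) hs.le
    refine le_trans ?_ (mul_le_mul_of_nonneg_left h3 (by positivity))
    have : (1 + 2 / s ^ 2) * (1 + s ^ 2 * x ^ 2 / 2) = 1 + x ^ 2 + (s ^ 2 * x ^ 2 / 2 + 2 / s ^ 2) := by
      field_simp; ring
    rw [this]
    linarith [show 0 ≤ s ^ 2 * x ^ 2 / 2 + 2 / s ^ 2 by positivity]
  have hc : 0 < Real.cosh x ^ s := Real.rpow_pos_of_pos (Real.cosh_pos x) s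
  rw [psi, Real.inv_rpow (Real.cosh_pos x).le, ← div_eq_mul_inv, inv_eq_one_div,
    div_le_div_iff₀ hc (by positivity)]
  linarith

lemma psi_rpow_continuous {s : ℝ} (hs : 0 < s) : Continuous fun x => psi x ^ s :=
  psi_continuous.rpow_const fun _ => Or.inr hs.le

lemma psi_rpow_pos (s x : ℝ) : 0 < psi x ^ s := Real.rpow_pos_of_pos (psi_pos x) s

lemma psi_rpow_integrable {s : ℝ} (hs : 0 < s) : Integrable fun x => psi x ^ s := by
  refine (integrable_inv_one_add_sq.const_mul (2 ^ s * (1 + 2 / s ^ 2))).mono'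
    (psi_rpow_continuous hs).aestronglyMeasurable (Eventually.of_forall fun x => ?_)
  rw [Real.norm_of_nonneg (psi_rpow_pos s x).le]
  exact psi_rpow_le hs x

lemma psi_rpow_mul (s t x : ℝ) : psi x ^ s * psi x ^ t = psi x ^ (s + t) :=
  (Real.rpow_add (psi_pos x) s t).symm

lemma psi_rpow_add_two (s x : ℝ) : psi x ^ (s + 2) = psi x ^ s * psi x ^ 2 := by
  rw [Real.rpow_add (psi_pos x), Real.rpow_two]

lemma psi_hasDerivAt (x : ℝ) : HasDerivAt psi (-(phi x * psi x)) x := by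
  refine ((Real.hasDerivAt_cosh x).inv (Real.cosh_pos x).ne').congr_deriv ?_
  have := (Real.cosh_pos x).ne'
  rw [phi, psi, Real.tanh_eq_sinh_div_cosh]
  field_simp

lemma psi_rpow_hasDerivAt (s x : ℝ) :
    HasDerivAt (fun x => psi x ^ s) (-s * (phi x * psi x ^ s)) x := by
  refine ((psi_hasDerivAt x).rpow_const (Or.inl (psi_pos x).ne')).congr_deriv ?_
  have : psi x ^ s = psi x ^ (s - 1) * psi x := by
    rw [← Real.rpow_add_one (psi_pos x).ne', sub_add_cancel]
  rw [this]; ring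

lemma phi_mul_psi_rpow_hasDerivAt (s x : ℝ) :
    HasDerivAt (fun x => phi x * psi x ^ s) ((s + 1) * psi x ^ (s + 2) - s * psi x ^ s) x := by
  refine ((phi_hasDerivAt x).mul (psi_rpow_hasDerivAt s x)).congr_deriv ?_
  rw [psi_rpow_add_two]
  linear_combination (-s * psi x ^ s) * phi_sq x

/-- The moment `∫ ψ^s`. -/
def psiMoment (s : ℝ) : ℝ := ∫ x, psi x ^ s

lemma psiMoment_pos {s : ℝ} (hs : 0 < s) : 0 < psiMoment s := by
  rw [psiMoment, integral_pos_iff_support_of_nonneg (fun x => (psi_rpow_pos s x).le)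
    (psi_rpow_integrable hs), Function.support_eq_univ (f := fun x => psi x ^ s)
      fun x => (psi_rpow_pos s x).ne']
  simp

lemma phi_abs_le (x : ℝ) : |phi x| ≤ 1 := (Real.abs_tanh_lt_one x).le

lemma phi_mul_psi_rpow_integrable {s : ℝ} (hs : 0 < s) : Integrable fun x => phi x * psi x ^ s :=
  (psi_rpow_integrable hs).bdd_mul (c := 1) phi_continuous.aestronglyMeasurable
    (Eventually.of_forall phi_abs_le)

lemma psiMoment_add_two {s : ℝ} (hs : 0 < s) : (s + 1) * psiMoment (s + 2) = s * psiMoment s := by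
  have i1 := (psi_rpow_integrable (show 0 < s + 2 by linarith)).const_mul (s + 1)
  have i2 := (psi_rpow_integrable hs).const_mul s
  have := integral_eq_zero_of_hasDerivAt_of_integrable (phi_mul_psi_rpow_hasDerivAt s)
    (i1.sub i2) (phi_mul_psi_rpow_integrable hs)
  rw [integral_sub i1 i2, integral_const_mul, integral_const_mul, sub_eq_zero] at this
  exact this

lemma psi_rpow_memLp {s : ℝ} (hs : 0 < s) : MemLp (fun x => ((psi x ^ s : ℝ) : ℂ)) 2 volume := by
  refine MemLp.ofReal ((memLp_two_iff_integrable_sq (psi_rpow_continuous hs).aestronglyMeasurable).2 ?_)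
  refine (psi_rpow_integrable (show 0 < s + s by linarith)).congr (Eventually.of_forall fun x => ?_)
  simp only [← psi_rpow_mul, sq]

lemma phi_mul_psi_rpow_memLp {s : ℝ} (hs : 0 < s) :
    MemLp (fun x => ((phi x * psi x ^ s : ℝ) : ℂ)) 2 volume :=
  (psi_rpow_memLp hs).of_le (Complex.continuous_ofReal.comp
    (phi_continuous.mul (psi_rpow_continuous hs))).aestronglyMeasurable
    (Eventually.of_forall fun x => by
      rw [Complex.norm_real, Complex.norm_real, norm_mul]
      exact mul_le_of_le_one_left (norm_nonneg _) (phi_abs_le x))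

/-- The even function `ψ^s`, for `s > 0`, as an element of `L²(ℝ)`. -/
def evL (s : ℝ) (hs : 0 < s) : L2 := (psi_rpow_memLp hs).toLp _

/-- The odd function `φψ^s`, for `s > 0`, as an element of `L²(ℝ)`. -/
def odL (s : ℝ) (hs : 0 < s) : L2 := (phi_mul_psi_rpow_memLp hs).toLp _

lemma coeFn_evL (s : ℝ) (hs : 0 < s) : evL s hs =ᵐ[volume] fun x => ((psi x ^ s : ℝ) : ℂ) :=
  (psi_rpow_memLp hs).coeFn_toLp

lemma coeFn_odL (s : ℝ) (hs : 0 < s) :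
    odL s hs =ᵐ[volume] fun x => ((phi x * psi x ^ s : ℝ) : ℂ) :=
  (phi_mul_psi_rpow_memLp hs).coeFn_toLp

lemma psiL2_eq : psiL2 = evL 1 one_pos := by
  apply Lp.ext
  filter_upwards [psi_memLp.coeFn_toLp, coeFn_evL 1 one_pos] with x h1 h2
  rw [psiL2, h1, h2, Real.rpow_one]

lemma dphiL2_eq : dphiL2 = evL 2 two_pos := by
  apply Lp.ext
  filter_upwards [dphi_memLp.coeFn_toLp, coeFn_evL 2 two_pos] with x h1 h2
  rw [dphiL2, h1, h2, Real.rpow_two, deriv_phi]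

lemma mulOp_psi_psi_evL (s : ℝ) (hs : 0 < s) :
    mulOp psiB (mulOp psiB (evL s hs)) = evL (s + 2) (by linarith) := by
  apply Lp.ext
  filter_upwards [coeFn_mulOp psiB (mulOp psiB (evL s hs)), coeFn_mulOp psiB (evL s hs),
    coeFn_evL s hs, coeFn_evL (s + 2) (by linarith)] with x h1 h2 h3 h4
  rw [h1, h2, h3, h4, psi_rpow_add_two, psiB_apply]
  push_cast; ring

lemma mulOp_psi_psi_odL (s : ℝ) (hs : 0 < s) :
    mulOp psiB (mulOp psiB (odL s hs)) = odL (s + 2) (by linarith) := by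
  apply Lp.ext
  filter_upwards [coeFn_mulOp psiB (mulOp psiB (odL s hs)), coeFn_mulOp psiB (odL s hs),
    coeFn_odL s hs, coeFn_odL (s + 2) (by linarith)] with x h1 h2 h3 h4
  rw [h1, h2, h3, h4, psi_rpow_add_two, psiB_apply]
  push_cast; ring

lemma evL_eq_res (s : ℝ) (hs : 0 < s) : evL s hs = res 4 four_pos
    (((4 - s ^ 2 : ℝ) : ℂ) • evL s hs + ((s * (s + 1) : ℝ) : ℂ) • evL (s + 2) (by linarith)) := by
  have hs2 : 0 < s + 2 := by linarith
  have e2 : ((s ^ 2 : ℝ) : ℂ) • evL s hs + ((-(s * (s + 1)) : ℝ) : ℂ) • evL (s + 2) hs2 =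
      MemLp.toLp _ (((psi_rpow_memLp hs).const_smul ((s ^ 2 : ℝ) : ℂ)).add
        ((psi_rpow_memLp hs2).const_smul ((-(s * (s + 1)) : ℝ) : ℂ))) := rfl
  have h := toLp_eq_res (u := fun x => ((psi x ^ s : ℝ) : ℂ))
    (u' := (((-s : ℝ) : ℂ) • fun x => ((phi x * psi x ^ s : ℝ) : ℂ)))
    (fun x => (psi_rpow_hasDerivAt s x).ofReal_comp.congr_deriv (by simp))
    (fun x => ((phi_mul_psi_rpow_hasDerivAt s x).ofReal_comp.const_smul ((-s : ℝ) : ℂ)).congr_deriv (by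
      simp only [Pi.add_apply, Pi.smul_apply, smul_eq_mul]; push_cast; ring))
    (psi_rpow_memLp hs) ((phi_mul_psi_rpow_memLp hs).const_smul _)
    (((psi_rpow_memLp hs).const_smul ((s ^ 2 : ℝ) : ℂ)).add
        ((psi_rpow_memLp hs2).const_smul ((-(s * (s + 1)) : ℝ) : ℂ)))
  rw [← e2] at h
  refine h.trans (congrArg _ ?_)
  change (4 : ℂ) • evL s hs - _ = _
  push_cast
  module

lemma odL_eq_res (s : ℝ) (hs : 0 < s) : odL s hs = res 4 four_pos
    (((4 - s ^ 2 : ℝ) : ℂ) • odL s hs + (((s + 1) * (s + 2) : ℝ) : ℂ) • odL (s + 2) (by linarith)) := by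
  have hs2 : 0 < s + 2 := by linarith
  have e2 : ((s ^ 2 : ℝ) : ℂ) • odL s hs + ((-((s + 1) * (s + 2)) : ℝ) : ℂ) • odL (s + 2) hs2 =
      MemLp.toLp _ (((phi_mul_psi_rpow_memLp hs).const_smul ((s ^ 2 : ℝ) : ℂ)).add
        ((phi_mul_psi_rpow_memLp hs2).const_smul ((-((s + 1) * (s + 2)) : ℝ) : ℂ))) := rfl
  have h := toLp_eq_res (u := fun x => ((phi x * psi x ^ s : ℝ) : ℂ))
    (u' := ((((s + 1 : ℝ) : ℂ) • fun x => ((psi x ^ (s + 2) : ℝ) : ℂ)) +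
      (((-s : ℝ) : ℂ) • fun x => ((psi x ^ s : ℝ) : ℂ))))
    (fun x => (phi_mul_psi_rpow_hasDerivAt s x).ofReal_comp.congr_deriv (by
      simp only [Pi.add_apply, Pi.smul_apply, smul_eq_mul]; push_cast; ring))
    (fun x => (((psi_rpow_hasDerivAt (s + 2) x).ofReal_comp.const_smul ((s + 1 : ℝ) : ℂ)).add
      ((psi_rpow_hasDerivAt s x).ofReal_comp.const_smul ((-s : ℝ) : ℂ))).congr_deriv (by
      simp only [Pi.add_apply, Pi.smul_apply, smul_eq_mul]; push_cast; ring))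
    (phi_mul_psi_rpow_memLp hs)
    (((psi_rpow_memLp hs2).const_smul _).add ((psi_rpow_memLp hs).const_smul _))
    (((phi_mul_psi_rpow_memLp hs).const_smul ((s ^ 2 : ℝ) : ℂ)).add
        ((phi_mul_psi_rpow_memLp hs2).const_smul ((-((s + 1) * (s + 2)) : ℝ) : ℂ)))
  rw [← e2] at h
  refine h.trans (congrArg _ ?_)
  change (4 : ℂ) • odL s hs - _ = _
  push_cast
  module

lemma inner_odL_evL (s t : ℝ) (hs : 0 < s) (ht : 0 < t) : ⟪odL s hs, evL t ht⟫_ℂ = 0 := by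
  have e : (fun x => ⟪odL s hs x, evL t ht x⟫_ℂ) =ᵐ[volume]
      fun x => ((phi x * psi x ^ (s + t) : ℝ) : ℂ) := by
    filter_upwards [coeFn_odL s hs, coeFn_evL t ht] with x h1 h2
    rw [h1, h2, ← psi_rpow_mul]
    simp only [RCLike.inner_apply, Complex.conj_ofReal]
    push_cast; ring
  rw [L2.inner_def, integral_congr_ae e]
  -- the integrand is odd
  have h := integral_neg_eq_self (fun x => ((phi x * psi x ^ (s + t) : ℝ) : ℂ)) volume
  have h2 : (fun x => ((phi (-x) * psi (-x) ^ (s + t) : ℝ) : ℂ)) =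
      fun x => -((phi x * psi x ^ (s + t) : ℝ) : ℂ) := by
    funext x
    simp [phi, psi, Real.tanh_neg, Real.cosh_neg]
  rw [h2, integral_neg] at h
  exact self_eq_neg.1 h.symm

lemma inner_evL_evL (s t : ℝ) (hs : 0 < s) (ht : 0 < t) :
    ⟪evL s hs, evL t ht⟫_ℂ = (psiMoment (s + t) : ℂ) := by
  have e : (fun x => ⟪evL s hs x, evL t ht x⟫_ℂ) =ᵐ[volume]
      fun x => ((psi x ^ (s + t) : ℝ) : ℂ) := by
    filter_upwards [coeFn_evL s hs, coeFn_evL t ht] with x h1 h2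
    rw [h1, h2, ← psi_rpow_mul]
    simp only [RCLike.inner_apply, Complex.conj_ofReal]
    push_cast; ring
  rw [L2.inner_def, integral_congr_ae e, integral_complex_ofReal, psiMoment]

lemma inner_odL_odL (s t : ℝ) (hs : 0 < s) (ht : 0 < t) :
    ⟪odL s hs, odL t ht⟫_ℂ = ((psiMoment (s + t) / (s + t + 1) : ℝ) : ℂ) := by
  have e : (fun x => ⟪odL s hs x, odL t ht x⟫_ℂ) =ᵐ[volume]
      fun x => ((psi x ^ (s + t) - psi x ^ (s + t + 2) : ℝ) : ℂ) := by
    filter_upwards [coeFn_odL s hs, coeFn_odL t ht] with x h1 h2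
    have h3 : psi x ^ (s + t) - psi x ^ (s + t + 2) = (phi x * psi x ^ s) * (phi x * psi x ^ t) := by
      rw [psi_rpow_add_two, ← psi_rpow_mul]
      linear_combination (-(psi x ^ s * psi x ^ t)) * phi_sq x
    rw [h1, h2, h3]
    simp only [RCLike.inner_apply, Complex.conj_ofReal]
    push_cast; ring
  have hst : 0 < s + t := by linarith
  have h4 := psiMoment_add_two hst
  rw [L2.inner_def, integral_congr_ae e, integral_complex_ofReal, integral_sub (psi_rpow_integrable hst)
    (psi_rpow_integrable (by linarith)), ← psiMoment, ← psiMoment]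
  have : psiMoment (s + t) - psiMoment (s + t + 2) = psiMoment (s + t) / (s + t + 1) := by
    field_simp
    linarith
  rw [this]

/-! ### Attainment of constrained Rayleigh quotients -/

section Abstract

variable {H : Type*} [NormedAddCommGroup H] [InnerProductSpace ℂ H]

/-- Cauchy–Schwarz for a symmetric operator that is nonnegative on a subspace. -/
lemma norm_starProjection_sq_le (V : Submodule ℂ H) [V.HasOrthogonalProjection] (M : H →L[ℂ] H)
    (hM : ∀ x y, ⟪M x, y⟫_ℂ = ⟪x, M y⟫_ℂ) (hpos : ∀ x ∈ V, 0 ≤ RCLike.re ⟪M x, x⟫_ℂ) {x : H}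
    (hx : x ∈ V) :
    ‖V.starProjection (M x)‖ ^ 2 ≤ (‖M‖ + 1) * RCLike.re ⟪M x, x⟫_ℂ := by
  set y := V.starProjection (M x) with hy
  have hyV : y ∈ V := V.starProjection_apply_mem _
  have h1 : ⟪M x, y⟫_ℂ = ⟪y, y⟫_ℂ := by
    rw [← sub_eq_zero, ← inner_sub_left]
    exact (Submodule.mem_orthogonal' V _).1 (V.sub_starProjection_mem_orthogonal (M x)) y hyV
  set t : ℝ := (‖M‖ + 1)⁻¹ with ht
  have hN : 0 < ‖M‖ + 1 := by positivity
  have ht0 : 0 < t := inv_pos.2 hN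
  have h2 := hpos (x - (t : ℂ) • y) (V.sub_mem hx (V.smul_mem _ hyV))
  have h3 : RCLike.re ⟪M (x - (t : ℂ) • y), x - (t : ℂ) • y⟫_ℂ =
      RCLike.re ⟪M x, x⟫_ℂ - 2 * t * ‖y‖ ^ 2 + t ^ 2 * RCLike.re ⟪M y, y⟫_ℂ := by
    have h4 : ⟪M y, x⟫_ℂ = ⟪y, y⟫_ℂ := by
      rw [hM, ← inner_conj_symm, h1, inner_self_conj]
    rw [map_sub, map_smul, inner_sub_left, inner_sub_right, inner_sub_right, inner_smul_left,
      inner_smul_left, inner_smul_right, inner_smul_right, h1, h4, Complex.conj_ofReal]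
    have h5 : (⟪y, y⟫_ℂ).re = ‖y‖ ^ 2 := inner_self_eq_norm_sq (𝕜 := ℂ) y
    simp only [RCLike.re_eq_complex_re, Complex.sub_re, Complex.re_ofReal_mul, h5]
    ring
  have h5 : RCLike.re ⟪M y, y⟫_ℂ ≤ ‖M‖ * ‖y‖ ^ 2 := by
    refine (re_inner_le_norm _ _).trans ?_
    rw [sq, ← mul_assoc]
    exact mul_le_mul_of_nonneg_right (M.le_opNorm y) (norm_nonneg _)
  rw [h3] at h2
  have h6 : t ^ 2 * RCLike.re ⟪M y, y⟫_ℂ ≤ t * ‖y‖ ^ 2 := by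
    have : t * ‖M‖ ≤ 1 := by
      rw [ht, inv_mul_le_iff₀ hN]; linarith
    calc t ^ 2 * RCLike.re ⟪M y, y⟫_ℂ ≤ t ^ 2 * (‖M‖ * ‖y‖ ^ 2) := by gcongr
      _ = t * ‖y‖ ^ 2 * (t * ‖M‖) := by ring
      _ ≤ t * ‖y‖ ^ 2 := mul_le_of_le_one_right (by positivity) this
  have h7 : t * ‖y‖ ^ 2 ≤ RCLike.re ⟪M x, x⟫_ℂ := by linarith
  rw [ht, inv_mul_le_iff₀ hN] at h7
  exact h7

/-- A nonnegative form `coercive + compact` without a positive lower bound on the unit sphere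
has a null vector. -/
lemma exists_null_of_tendsto [CompleteSpace H] (V : Submodule ℂ H) [V.HasOrthogonalProjection]
    (hV : IsClosed (V : Set H)) (M E K : H →L[ℂ] H)
    (hM : ∀ x y, ⟪M x, y⟫_ℂ = ⟪x, M y⟫_ℂ) (hpos : ∀ x ∈ V, 0 ≤ RCLike.re ⟪M x, x⟫_ℂ)
    (hEK : M = E + K) {c : ℝ} (hc : 0 < c) (hE : ∀ x, c * ‖x‖ ^ 2 ≤ RCLike.re ⟪E x, x⟫_ℂ)
    (hK : IsCompactOperator K) (g : ℕ → H) (hgV : ∀ n, g n ∈ V) (hg1 : ∀ n, ‖g n‖ = 1)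
    (hlim : Tendsto (fun n => RCLike.re ⟪M (g n), g n⟫_ℂ) atTop (𝓝 0)) :
    ∃ x ∈ V, ‖x‖ = 1 ∧ M x ∈ Vᗮ := by
  have h1 : Tendsto (fun n => V.starProjection (M (g n))) atTop (𝓝 0) := by
    rw [tendsto_zero_iff_norm_tendsto_zero]
    have h2 : Tendsto (fun n => ‖V.starProjection (M (g n))‖ ^ 2) atTop (𝓝 0) := by
      refine squeeze_zero (fun n => by positivity)
        (fun n => norm_starProjection_sq_le V M hM hpos (hgV n)) ?_
      simpa using hlim.const_mul (‖M‖ + 1)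
    have h3 := (Real.continuous_sqrt.tendsto 0).comp h2
    simpa [Function.comp_def, Real.sqrt_sq] using h3
  obtain ⟨C, hC, hKC⟩ := hK.image_closedBall_subset_compact 1
  obtain ⟨y, -, ns, hns, hy⟩ := hC.tendsto_subseq
    (fun n => hKC ⟨g n, by simp [hg1], rfl⟩ : ∀ n, K (g n) ∈ C)
  have h4 : Tendsto (fun n => V.starProjection (E (g (ns n)))) atTop
      (𝓝 (0 - V.starProjection y)) := by
    refine ((h1.comp hns.tendsto_atTop).sub ((V.starProjection.continuous.tendsto y).comp hy)).congr
      fun n => ?_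
    simp only [Function.comp_apply, hEK, add_apply, map_add, add_sub_cancel_right]
  have h5 : ∀ m n, c * ‖g (ns m) - g (ns n)‖ ≤
      ‖V.starProjection (E (g (ns m))) - V.starProjection (E (g (ns n)))‖ := by
    intro m n
    set d := g (ns m) - g (ns n) with hd
    have hdV : d ∈ V := V.sub_mem (hgV _) (hgV _)
    rw [← map_sub, ← map_sub, ← hd]
    have h6 : ⟪E d, d⟫_ℂ = ⟪V.starProjection (E d), d⟫_ℂ := by
      rw [← sub_eq_zero, ← inner_sub_left]
      exact (Submodule.mem_orthogonal' V _).1 (V.sub_starProjection_mem_orthogonal (E d)) d hdV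
    have h7 := hE d
    rw [h6] at h7
    have h8 := h7.trans (re_inner_le_norm _ _)
    rcases eq_or_lt_of_le (norm_nonneg d) with h0 | h0
    · rw [← h0, mul_zero]; exact norm_nonneg _
    · rw [sq, ← mul_assoc] at h8
      exact le_of_mul_le_mul_right h8 h0
  have hcau : CauchySeq fun n => g (ns n) := by
    rw [Metric.cauchySeq_iff]
    intro ε hε
    obtain ⟨N, hN⟩ := Metric.cauchySeq_iff.1 h4.cauchySeq (c * ε) (by positivity)
    refine ⟨N, fun m hm n hn => ?_⟩
    have := hN m hm n hn
    rw [dist_eq_norm] at this ⊢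
    exact lt_of_mul_lt_mul_left ((h5 m n).trans_lt this) hc.le
  obtain ⟨x, hx⟩ := cauchySeq_tendsto_of_complete hcau
  refine ⟨x, hV.mem_of_tendsto hx (Eventually.of_forall fun n => hgV _), ?_, ?_⟩
  · exact tendsto_nhds_unique hx.norm (by simp [hg1])
  · have h9 : V.starProjection (M x) = 0 :=
      tendsto_nhds_unique (((V.starProjection ∘L M).continuous.tendsto x).comp hx)
        (h1.comp hns.tendsto_atTop)
    have := V.sub_starProjection_mem_orthogonal (M x)
    rwa [h9, sub_zero] at this

/-- **Existence of constrained Rayleigh minimizers.** If a trial vector lies below the threshold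
`θ`, under which `A - ρS` is a compact perturbation of a coercive operator, then the quotient
`⟨Ax, x⟩ / ⟨Sx, x⟩` attains its infimum on `V`. -/
theorem exists_rayleigh_min [CompleteSpace H] (V : Submodule ℂ H) [V.HasOrthogonalProjection]
    (hV : IsClosed (V : Set H)) (A S : H →L[ℂ] H)
    (hA : ∀ x y, ⟪A x, y⟫_ℂ = ⟪x, A y⟫_ℂ) (hS : ∀ x y, ⟪S x, y⟫_ℂ = ⟪x, S y⟫_ℂ)
    (hA0 : ∀ x ∈ V, 0 ≤ RCLike.re ⟪A x, x⟫_ℂ)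
    (hS0 : ∀ x ∈ V, x ≠ 0 → 0 < RCLike.re ⟪S x, x⟫_ℂ) (θ : ℝ)
    (htest : ∃ x ∈ V, x ≠ 0 ∧ RCLike.re ⟪A x, x⟫_ℂ < θ * RCLike.re ⟪S x, x⟫_ℂ)
    (hEK : ∀ ρ : ℝ, 0 ≤ ρ → ρ < θ → ∃ E K : H →L[ℂ] H, ∃ c > 0, A - (ρ : ℂ) • S = E + K ∧
      (∀ x, c * ‖x‖ ^ 2 ≤ RCLike.re ⟪E x, x⟫_ℂ) ∧ IsCompactOperator K) :
    ∃ ρ : ℝ, 0 ≤ ρ ∧ ∃ x ∈ V, x ≠ 0 ∧ RCLike.re ⟪A x, x⟫_ℂ = ρ * RCLike.re ⟪S x, x⟫_ℂ ∧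
      (∀ y ∈ V, ρ * RCLike.re ⟪S y, y⟫_ℂ ≤ RCLike.re ⟪A y, y⟫_ℂ) ∧
      A x - (ρ : ℂ) • S x ∈ Vᗮ := by
  set q : H → ℝ := fun x => RCLike.re ⟪A x, x⟫_ℂ / RCLike.re ⟪S x, x⟫_ℂ with hq
  set Q : Set ℝ := q '' {x | x ∈ V ∧ x ≠ 0} with hQ
  have hbdd : BddBelow Q := ⟨0, by
    rintro _ ⟨x, ⟨hx, hx0⟩, rfl⟩
    exact div_nonneg (hA0 x hx) (hS0 x hx hx0).le⟩
  obtain ⟨x0, hx0V, hx00, hx0t⟩ := htest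
  have hne : Q.Nonempty := ⟨q x0, x0, ⟨hx0V, hx00⟩, rfl⟩
  set ρ := sInf Q with hρ
  have hρ0 : 0 ≤ ρ := le_csInf hne (by
    rintro _ ⟨x, ⟨hx, hx0⟩, rfl⟩
    exact div_nonneg (hA0 x hx) (hS0 x hx hx0).le)
  have hρθ : ρ < θ := lt_of_le_of_lt (csInf_le hbdd ⟨x0, ⟨hx0V, hx00⟩, rfl⟩)
    ((div_lt_iff₀ (hS0 x0 hx0V hx00)).2 hx0t)
  have hmin : ∀ y ∈ V, ρ * RCLike.re ⟪S y, y⟫_ℂ ≤ RCLike.re ⟪A y, y⟫_ℂ := by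
    intro y hy
    rcases eq_or_ne y 0 with rfl | hy0
    · simp
    · exact (le_div_iff₀ (hS0 y hy hy0)).1 (csInf_le hbdd ⟨y, ⟨hy, hy0⟩, rfl⟩)
  obtain ⟨E, K, c, hc, hEKM, hE, hK⟩ := hEK ρ hρ0 hρθ
  set M := A - (ρ : ℂ) • S with hMdef
  have hMre : ∀ x, RCLike.re ⟪M x, x⟫_ℂ = RCLike.re ⟪A x, x⟫_ℂ - ρ * RCLike.re ⟪S x, x⟫_ℂ := by
    intro x
    simp only [hMdef, sub_apply, smul_apply, inner_sub_left, inner_smul_left, Complex.conj_ofReal,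
      RCLike.re_eq_complex_re, Complex.sub_re, Complex.re_ofReal_mul]
  have hMsymm : ∀ x y, ⟪M x, y⟫_ℂ = ⟪x, M y⟫_ℂ := by
    intro x y
    simp only [hMdef, sub_apply, smul_apply, inner_sub_left, inner_sub_right, inner_smul_left,
      inner_smul_right, Complex.conj_ofReal, hA, hS]
  have hMpos : ∀ x ∈ V, 0 ≤ RCLike.re ⟪M x, x⟫_ℂ := fun x hx => by
    rw [hMre]; linarith [hmin x hx]
  have hseq : ∀ n : ℕ, ∃ x ∈ V, ‖x‖ = 1 ∧ RCLike.re ⟪M x, x⟫_ℂ ≤ (1 / ((n : ℝ) + 1)) * ‖S‖ := by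
    intro n
    obtain ⟨_, ⟨x, ⟨hxV, hx0⟩, rfl⟩, hlt⟩ := exists_lt_of_csInf_lt hne
      (lt_add_of_pos_right ρ (Nat.one_div_pos_of_nat (n := n) (α := ℝ)))
    have hnx : ‖x‖ ≠ 0 := norm_ne_zero_iff.2 hx0
    refine ⟨((‖x‖⁻¹ : ℝ) : ℂ) • x, V.smul_mem _ hxV, ?_, ?_⟩
    · rw [norm_smul, Complex.norm_real, norm_inv, norm_norm, inv_mul_cancel₀ hnx]
    · have hSx := hS0 x hxV hx0
      have h1 : RCLike.re ⟪M x, x⟫_ℂ ≤ (1 / ((n : ℝ) + 1)) * RCLike.re ⟪S x, x⟫_ℂ := by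
        rw [hMre]
        have := (div_lt_iff₀ hSx).1 hlt
        linarith
      have h2 : RCLike.re ⟪S x, x⟫_ℂ ≤ ‖S‖ * ‖x‖ ^ 2 := by
        refine (re_inner_le_norm _ _).trans ?_
        rw [sq, ← mul_assoc]
        exact mul_le_mul_of_nonneg_right (S.le_opNorm x) (norm_nonneg _)
      rw [map_smul, inner_smul_left, inner_smul_right, Complex.conj_ofReal, RCLike.re_eq_complex_re,
        Complex.re_ofReal_mul, Complex.re_ofReal_mul, ← RCLike.re_eq_complex_re, ← mul_assoc]
      calc ‖x‖⁻¹ * ‖x‖⁻¹ * RCLike.re ⟪M x, x⟫_ℂ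
          ≤ ‖x‖⁻¹ * ‖x‖⁻¹ * ((1 / ((n : ℝ) + 1)) * (‖S‖ * ‖x‖ ^ 2)) := by
            gcongr; exact h1.trans (by gcongr)
        _ = _ := by field_simp
  choose g hgV hg1 hgM using hseq
  obtain ⟨x, hxV, hx1, hxM⟩ := exists_null_of_tendsto V hV M E K hMsymm hMpos hEKM hc hE hK g hgV hg1
    (squeeze_zero (fun n => hMpos _ (hgV n)) hgM (by
      simpa using (tendsto_one_div_add_atTop_nhds_zero_nat (𝕜 := ℝ)).mul_const ‖S‖))
  refine ⟨ρ, hρ0, x, hxV, ?_, ?_, hmin, hxM⟩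
  · rw [← norm_ne_zero_iff, hx1]; exact one_ne_zero
  · have h := (Submodule.mem_orthogonal' V _).1 hxM x hxV
    have h2 := hMre x
    rw [h, map_zero] at h2
    linarith

end Abstract

/-! ### The operator `D` and its bounded inverse -/

lemma mulPsiSq_eq (u : L2) : mulPsiSq u = mulOp psiB (mulOp psiB u) := by
  apply Lp.ext
  filter_upwards [(psi_sq_mul_memLp u).coeFn_toLp, coeFn_mulOp psiB (mulOp psiB u),
    coeFn_mulOp psiB u] with z h1 h2 h3
  change ((psi_sq_mul_memLp u).toLp _ : ℝ → ℂ) z = _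
  rw [h1, h2, h3, psiB_apply]
  push_cast; ring

lemma inner_mulOp_psi (u v : L2) : ⟪mulOp psiB u, v⟫_ℂ = ⟪u, mulOp psiB v⟫_ℂ := by
  rw [inner_mulOp]
  congr 2
  congr 1
  ext z
  simp [psiB_apply]

/-- The orthogonal projection onto `ψ`, up to the factor `‖ψ‖²`. -/
def psiProj : L2 →L[ℂ] L2 := (innerSL ℂ psiL2).smulRight psiL2

lemma psiProj_apply (u : L2) : psiProj u = ⟪psiL2, u⟫_ℂ • psiL2 := rfl

/-- The operator `(D_μ + κ ⟨ψ, ·⟩ψ)(-∂² + 4)⁻¹`, which is bounded on `L²(ℝ)`. -/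
def opDR (μ κ : ℝ) : L2 →L[ℂ] L2 :=
  ContinuousLinearMap.id ℂ L2 + ((μ - 3 : ℝ) : ℂ) • res 4 four_pos -
    (2 : ℂ) • (mulOp psiB ∘L mulOp psiB ∘L res 4 four_pos) + (κ : ℂ) • (psiProj ∘L res 4 four_pos)

lemma opDR_apply (μ κ : ℝ) (h : L2) : opDR μ κ h = h + ((μ - 3 : ℝ) : ℂ) • res 4 four_pos h -
    (2 : ℂ) • mulOp psiB (mulOp psiB (res 4 four_pos h)) +
      ((κ : ℂ) * ⟪psiL2, res 4 four_pos h⟫_ℂ) • psiL2 := by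
  change h + ((μ - 3 : ℝ) : ℂ) • res 4 four_pos h -
    (2 : ℂ) • mulOp psiB (mulOp psiB (res 4 four_pos h)) + (κ : ℂ) • psiProj (res 4 four_pos h) = _
  rw [psiProj_apply, smul_smul]

lemma opD_res (μ : ℝ) (h : L2) (hh : res 4 four_pos h ∈ H2) :
    opD μ ⟨res 4 four_pos h, hh⟩ = opDR μ 0 h := by
  have : opD μ ⟨res 4 four_pos h, hh⟩ = -secondDeriv ⟨res 4 four_pos h, hh⟩
      - (2 : ℂ) • mulPsiSq (res 4 four_pos h) + ((μ + 1 : ℝ) : ℂ) • res 4 four_pos h := rfl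
  rw [this, secondDeriv_res, opDR_apply, mulPsiSq_eq]
  push_cast
  module

lemma opC_res (h : L2) (hh : res 4 four_pos h ∈ H2) :
    opC ⟨res 4 four_pos h, hh⟩ = h - (6 : ℂ) • mulOp psiB (mulOp psiB (res 4 four_pos h)) := by
  have : opC ⟨res 4 four_pos h, hh⟩ = -secondDeriv ⟨res 4 four_pos h, hh⟩
      - (6 : ℂ) • mulPsiSq (res 4 four_pos h) + (4 : ℂ) • res 4 four_pos h := rfl
  rw [this, secondDeriv_res, mulPsiSq_eq]
  module

lemma opDR_eq_of_orthogonal (μ κ : ℝ) {h : L2} (hh : ⟪psiL2, res 4 four_pos h⟫_ℂ = 0) :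
    opDR μ κ h = opDR μ 0 h := by
  simp [opDR_apply, hh]

lemma opDR_eq_add (μ κ : ℝ) (h : L2) :
    opDR μ κ h = opDR μ 0 h + ((κ : ℂ) * ⟪psiL2, res 4 four_pos h⟫_ℂ) • psiL2 := by
  simp [opDR_apply]

lemma eq_zero_of_res_four_eq_zero {h : L2} (hh : res 4 four_pos h = 0) : h = 0 := by
  have h1 := secondDeriv_res h (res_four_mem_H2 h)
  have h2 : (⟨res 4 four_pos h, res_four_mem_H2 h⟩ : H2) = 0 := Subtype.ext hh
  rw [h2, map_zero, hh, smul_zero, zero_sub] at h1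
  exact neg_eq_zero.1 h1.symm

lemma inner_opDR (μ κ : ℝ) (h k : L2) :
    ⟪opDR μ κ h, res 4 four_pos k⟫_ℂ = ⟪res 4 four_pos h, opDR μ κ k⟫_ℂ := by
  simp only [opDR_apply, inner_add_left, inner_sub_left, inner_add_right, inner_sub_right,
    inner_smul_left, inner_smul_right, inner_mulOp_psi, Complex.conj_ofReal, map_mul, map_ofNat,
    inner_conj_symm, ← inner_res 4 four_pos h k]
  ring

/-- `⟨D_μ u, u⟩ = ‖u' + φu‖² + μ‖u‖²`. -/
lemma re_inner_opDR (μ : ℝ) (h : L2) : RCLike.re ⟪opDR μ 0 h, res 4 four_pos h⟫_ℂ =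
    ‖opN (opJ h) + ((1 : ℕ) : ℂ) • mulOp phiB (opJ (opJ h))‖ ^ 2 + μ * ‖res 4 four_pos h‖ ^ 2 := by
  have e1 : ⟪h, opJ (opJ h)⟫_ℂ = ⟪opJ h, opJ h⟫_ℂ := (inner_opJ _ _).symm
  rw [norm_darboux_sq, opDR_apply, ← opJ_opJ]
  simp only [inner_add_left, inner_sub_left, inner_smul_left, inner_mulOp_psi _ (opJ (opJ h)), e1,
    Complex.ofReal_zero, zero_mul, zero_smul, add_zero, Complex.conj_ofReal, map_ofNat]
  rw [show (2 : ℂ) = ((2 : ℝ) : ℂ) by norm_num]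
  simp only [← inner_self_eq_norm_sq (𝕜 := ℂ), RCLike.re_eq_complex_re, Complex.add_re,
    Complex.sub_re, Complex.re_ofReal_mul]
  push_cast
  ring

lemma exists_eq_smul_psi {h : L2} (hh : RCLike.re ⟪opDR 0 0 h, res 4 four_pos h⟫_ℂ ≤ 0) :
    ∃ c : ℂ, res 4 four_pos h = c • psiL2 := by
  rw [re_inner_opDR, zero_mul, add_zero] at hh
  have h0 : opN (opJ h) + ((1 : ℕ) : ℂ) • mulOp phiB (opJ (opJ h)) = 0 := by
    rw [← norm_eq_zero]
    exact pow_eq_zero_iff two_ne_zero |>.1 (le_antisymm hh (by positivity))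
  obtain ⟨c, hc⟩ := exists_eq_psi_pow_of_darboux_eq_zero 1 _ h0
  refine ⟨c, ?_⟩
  rw [← opJ_opJ]
  apply Lp.ext
  filter_upwards [hc, psi_memLp.coeFn_toLp, Lp.coeFn_smul c psiL2] with x h1 h2 h3
  rw [h1, h3, Pi.smul_apply, psiL2, h2, pow_one, smul_eq_mul]

/-- The preimage of `ψ` under `(-∂² + 4)⁻¹`. -/
def psiPre : L2 := ((3 : ℝ) : ℂ) • evL 1 one_pos + ((2 : ℝ) : ℂ) • evL 3 three_pos

lemma res_psiPre : res 4 four_pos psiPre = psiL2 := by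
  rw [psiL2_eq]
  conv_rhs => rw [evL_eq_res 1 one_pos]
  rw [psiPre]
  congr 2
  · congr 1; norm_num
  · congr 1
    · norm_num
    · congr 1; norm_num

lemma opDR_psiPre (μ : ℝ) : opDR μ 0 psiPre = (μ : ℂ) • psiL2 := by
  have e : mulOp psiB (mulOp psiB (evL 1 one_pos)) = evL 3 three_pos := by
    rw [mulOp_psi_psi_evL]; congr 1; norm_num
  rw [opDR_apply, res_psiPre, psiL2_eq, e, psiPre]
  push_cast
  module

lemma inner_psi_opDR (μ : ℝ) (h : L2) :
    ⟪psiL2, opDR μ 0 h⟫_ℂ = μ * ⟪psiL2, res 4 four_pos h⟫_ℂ := by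
  rw [← res_psiPre, ← inner_opDR, opDR_psiPre, inner_smul_left, Complex.conj_ofReal, res_psiPre]

lemma psiL2_ne_zero : psiL2 ≠ 0 := by
  intro h
  have h1 := inner_evL_evL 1 1 one_pos one_pos
  rw [← psiL2_eq, h, inner_zero_left] at h1
  exact (psiMoment_pos (by norm_num : (0 : ℝ) < 1 + 1)).ne (by exact_mod_cast h1)

lemma inner_psi_dphi : ⟪psiL2, dphiL2⟫_ℂ = (psiMoment 3 : ℂ) := by
  rw [psiL2_eq, dphiL2_eq, inner_evL_evL]; norm_num

lemma dphiL2_ne_zero : dphiL2 ≠ 0 := by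
  intro h
  have h1 := inner_psi_dphi
  rw [h, inner_zero_right] at h1
  exact (psiMoment_pos three_pos).ne (by exact_mod_cast h1)

lemma isCompactOperator_psi_res : IsCompactOperator (mulOp psiB ∘L res 4 four_pos) := by
  have e : mulOp psiB ∘L res 4 four_pos = (mulOp psiB ∘L opJ) ∘L opJ := by
    ext1 u
    simp [opJ_opJ]
  rw [e]
  exact isCompactOperator_psi_opJ.comp_clm opJ

lemma isCompactOperator_psiProj : IsCompactOperator psiProj :=
  (isCompactOperator_of_locallyCompactSpace_dom (innerSL ℂ psiL2)).clm_comp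
      (ContinuousLinearMap.toSpanSingleton ℂ psiL2)

/-- The localized part of `-(D_μ + κ ⟨ψ, ·⟩ψ)(-∂² + 4)⁻¹`. -/
def locOp (κ : ℝ) : L2 →L[ℂ] L2 :=
  (2 : ℂ) • (mulOp psiB ∘L mulOp psiB ∘L res 4 four_pos) - (κ : ℂ) • (psiProj ∘L res 4 four_pos)

lemma isCompactOperator_locOp (κ : ℝ) : IsCompactOperator (locOp κ) :=
  ((isCompactOperator_psi_res.clm_comp (mulOp psiB)).smul (2 : ℂ)).sub
    ((isCompactOperator_psiProj.comp_clm (res 4 four_pos)).smul (κ : ℂ))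

lemma opDR_eq_sub_locOp (μ κ : ℝ) (h : L2) :
    opDR μ κ h = h + ((μ - 3 : ℝ) : ℂ) • res 4 four_pos h - locOp κ h := by
  simp only [opDR, locOp, add_apply, sub_apply, smul_apply, ContinuousLinearMap.id_apply]
  abel

lemma res_opDR (μ κ : ℝ) (hμ : 0 < μ + 1) (h : L2) :
    res (μ + 1) hμ (opDR μ κ h) = res 4 four_pos h - res (μ + 1) hμ (locOp κ h) := by
  rw [opDR_eq_sub_locOp, map_sub, map_add, map_smul, res_eq (μ + 1) 4 hμ four_pos h]
  push_cast
  module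

/-- If `D_μ + κ ⟨ψ, ·⟩ψ` is injective, it has a bounded self-adjoint inverse `B`, which differs from
the free resolvent by a compact operator. -/
lemma exists_inverse (μ κ : ℝ) (hμ : 0 < μ + 1) (hinj : ∀ h, opDR μ κ h = 0 → h = 0) :
    ∃ G B : L2 →L[ℂ] L2, (∀ f, B f = res 4 four_pos (G f)) ∧ (∀ f, opDR μ κ (G f) = f) ∧
      (∀ h, G (opDR μ κ h) = h) ∧ (∀ f g, ⟪B f, g⟫_ℂ = ⟪f, B g⟫_ℂ) ∧
      IsCompactOperator (B - res (μ + 1) hμ) := by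
  -- `U` inverts `(-∂² + μ + 1)(-∂² + 4)⁻¹`
  set U : L2 →L[ℂ] L2 := ContinuousLinearMap.id ℂ L2 + ((3 - μ : ℝ) : ℂ) • res (μ + 1) hμ with hU
  have hUapp : ∀ f, U f = f + ((3 - μ : ℝ) : ℂ) • res (μ + 1) hμ f := fun f => by simp [hU]
  set T : L2 →L[ℂ] L2 := U ∘L locOp κ with hT
  have hTc : IsCompactOperator T := (isCompactOperator_locOp κ).clm_comp U
  have hUD : ∀ h, U (opDR μ κ h) = h - T h := by
    intro h
    rw [hUapp, res_opDR, hT, ContinuousLinearMap.comp_apply, hUapp, opDR_eq_sub_locOp]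
    push_cast
    module
  have hDU : ∀ f, f + ((μ - 3 : ℝ) : ℂ) • res 4 four_pos f = 0 → f = 0 := by
    intro f hf
    have h1 := congrArg U hf
    rw [map_zero, hUapp, map_add, map_smul, res_eq (μ + 1) 4 hμ four_pos f] at h1
    rw [← h1]
    push_cast
    module
  have hUinj : ∀ f, U f = 0 → f = 0 := by
    intro f hf
    rw [hUapp] at hf
    have h1 : res 4 four_pos f = res (μ + 1) hμ f + ((μ - 3 : ℝ) : ℂ) • res 4 four_pos (res (μ + 1) hμ f) := by
      rw [res_eq 4 (μ + 1) four_pos hμ f]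
      congr 3; ring
    have h2 := congrArg (res 4 four_pos) hf
    rw [map_add, map_smul, map_zero, h1] at h2
    have h3 : res (μ + 1) hμ f = 0 := by
      rw [← h2]; push_cast; module
    simpa [h3] using hf
  have hbijT : Function.Bijective (ContinuousLinearMap.id ℂ L2 - T) := by
    have hres : (1 : ℂ) ∈ resolventSet ℂ T := by
      refine (hTc.hasEigenvalue_or_mem_resolventSet one_ne_zero).resolve_left fun hev => ?_
      obtain ⟨h, hh⟩ := hev.exists_hasEigenvector
      have h1 : T h = h := by simpa using hh.apply_eq_smul
      refine hh.2 (hinj h (hUinj _ ?_))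
      rw [hUD, h1, sub_self]
    rw [spectrum.mem_resolventSet_iff, map_one, ContinuousLinearMap.isUnit_iff_bijective] at hres
    exact hres
  have hbij : Function.Bijective (opDR μ κ) := by
    refine ⟨(injective_iff_map_eq_zero _).2 hinj, fun f => ?_⟩
    obtain ⟨h, hh⟩ := hbijT.2 (U f)
    refine ⟨h, ?_⟩
    have h1 : U (opDR μ κ h - f) = 0 := by
      rw [map_sub, hUD, sub_eq_zero]
      exact hh
    exact sub_eq_zero.1 (hUinj _ h1)
  set e := ContinuousLinearEquiv.ofBijective (opDR μ κ) (LinearMap.ker_eq_bot.2 hbij.1)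
    (LinearMap.range_eq_top.2 hbij.2) with he
  have hG1 : ∀ f, opDR μ κ (e.symm f) = f := fun f =>
    ContinuousLinearEquiv.ofBijective_apply_symm_apply _ _ _ f
  have hG2 : ∀ h, e.symm (opDR μ κ h) = h := fun h =>
    ContinuousLinearEquiv.ofBijective_symm_apply_apply _ _ _ h
  refine ⟨e.symm, res 4 four_pos ∘L (e.symm : L2 →L[ℂ] L2), fun f => rfl, hG1, hG2, fun f g => ?_, ?_⟩
  · have := inner_opDR μ κ (e.symm f) (e.symm g)
    rw [hG1, hG1] at this
    exact this.symm
  · have hB : res 4 four_pos ∘L (e.symm : L2 →L[ℂ] L2) - res (μ + 1) hμ =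
        res (μ + 1) hμ ∘L locOp κ ∘L (e.symm : L2 →L[ℂ] L2) := by
      ext1 f
      have := res_opDR μ κ hμ (e.symm f)
      rw [hG1] at this
      change res 4 four_pos (e.symm f) - res (μ + 1) hμ f = res (μ + 1) hμ (locOp κ (e.symm f))
      rw [this]
      abel
    rw [hB]
    exact ((isCompactOperator_locOp κ).comp_clm (e.symm : L2 →L[ℂ] L2)).clm_comp (res (μ + 1) hμ)

/-! ### Positivity of `D⁻¹` on the constraint space -/

lemma re_inner_opDR_zero_nonneg (h : L2) :
    0 ≤ RCLike.re ⟪opDR 0 0 h, res 4 four_pos h⟫_ℂ := by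
  rw [re_inner_opDR, zero_mul, add_zero]; positivity

lemma re_inner_opDR_one (h : L2) : RCLike.re ⟪opDR 0 1 h, res 4 four_pos h⟫_ℂ =
    RCLike.re ⟪opDR 0 0 h, res 4 four_pos h⟫_ℂ + ‖⟪psiL2, res 4 four_pos h⟫_ℂ‖ ^ 2 := by
  rw [opDR_eq_add 0 1, inner_add_left, map_add, inner_smul_left, Complex.ofReal_one, one_mul,
    ← Complex.normSq_eq_conj_mul_self, Complex.normSq_eq_norm_sq]
  rfl

/-- `D_0 + ⟨ψ, ·⟩ψ` is injective. -/
lemma opDR_zero_one_injective (h : L2) (hh : opDR 0 1 h = 0) : h = 0 := by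
  have h1 := re_inner_opDR_one h
  have h2 := re_inner_opDR_zero_nonneg h
  rw [hh, inner_zero_left, map_zero] at h1
  obtain ⟨c, hc⟩ := exists_eq_smul_psi (h := h) (by nlinarith [sq_nonneg ‖⟪psiL2, res 4 four_pos h⟫_ℂ‖])
  have h3 : ⟪psiL2, res 4 four_pos h⟫_ℂ = 0 := by
    rw [← norm_eq_zero, ← pow_eq_zero_iff two_ne_zero]
    nlinarith [sq_nonneg ‖⟪psiL2, res 4 four_pos h⟫_ℂ‖]
  refine eq_zero_of_res_four_eq_zero ?_
  rw [← inner_self_eq_zero (𝕜 := ℂ)]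
  conv_lhs => arg 2; rw [hc]
  rw [inner_smul_left, h3, mul_zero]

/-- The spectral gap of `D_0` above its kernel. -/
lemma exists_gap : ∃ k > 0, ∀ h : L2, ⟪psiL2, res 4 four_pos h⟫_ℂ = 0 →
    ‖res 4 four_pos h‖ ^ 2 ≤ k * RCLike.re ⟪opDR 0 0 h, res 4 four_pos h⟫_ℂ := by
  obtain ⟨G, B, hB, hDG, hGD, hsymm, -⟩ :=
    exists_inverse 0 1 (by norm_num) opDR_zero_one_injective
  refine ⟨‖B‖ + 1, by positivity, fun h hh => ?_⟩
  have h1 := norm_starProjection_sq_le (⊤ : Submodule ℂ L2) B hsymm (fun f _ => ?_)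
    (x := opDR 0 1 h) trivial
  · rw [hB, hGD, inner_re_symm, opDR_eq_of_orthogonal 0 1 hh] at h1
    simpa [Submodule.starProjection_top] using h1
  · rw [inner_re_symm, hB]
    nth_rw 1 [← hDG f]
    rw [re_inner_opDR_one]
    have := re_inner_opDR_zero_nonneg (G f)
    positivity

/-- The properties of `D_μ⁻¹` on the constraint space `X_*(μ) = w^⊥` on which the variational
argument rests; `B` is a bounded extension of `D_μ⁻¹` to `L²(ℝ)`. -/
structure IsConstrainedInverse (μ : ℝ) (hμ : 0 < μ + 1) (B : L2 →L[ℂ] L2) (w : L2) : Prop where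
  symm : ∀ f g, ⟪B f, g⟫_ℂ = ⟪f, B g⟫_ℂ
  compact : IsCompactOperator (B - res (μ + 1) hμ)
  Xstar_eq : Xstar μ = (ℂ ∙ w)ᗮ
  Dinv_eq : ∀ P ∈ Xstar μ, Dinv μ P = B P
  pos : ∀ P ∈ Xstar μ, P ≠ 0 → 0 < RCLike.re ⟪B P, P⟫_ℂ
  dphi_notMem : dphiL2 ∉ Xstar μ
  opDR_mem : ∀ h, ⟪psiL2, res 4 four_pos h⟫_ℂ = 0 → ⟪dphiL2, res 4 four_pos h⟫_ℂ = 0 →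
    opDR μ 0 h ∈ Xstar μ
  B_opDR : ∀ h, ⟪psiL2, res 4 four_pos h⟫_ℂ = 0 → B (opDR μ 0 h) = res 4 four_pos h

lemma Dinv_eq_of_unique {μ : ℝ} {f u : L2} (hu : ∃ h, u = res 4 four_pos h ∧ opDR μ 0 h = f)
    (horth : ∀ k, opDR μ 0 k = 0 → ⟪res 4 four_pos k, u⟫_ℂ = 0)
    (huniq : ∀ h, opDR μ 0 h = f → (∀ k, opDR μ 0 k = 0 →
      ⟪res 4 four_pos k, res 4 four_pos h⟫_ℂ = 0) → res 4 four_pos h = u) :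
    Dinv μ f = u := by
  have hex : ∃ v : (opD μ).domain, IsDInv μ f v := by
    obtain ⟨h, rfl, hh⟩ := hu
    refine ⟨⟨res 4 four_pos h, res_four_mem_H2 h⟩, (opD_res μ h _).trans hh, ?_⟩
    rintro ⟨_, hw⟩ hw0
    obtain ⟨k, rfl⟩ := exists_res_four hw
    exact horth k ((opD_res μ k hw).symm.trans hw0)
  rw [Dinv, dif_pos hex]
  have hs := hex.choose_spec
  generalize hex.choose = v at hs
  obtain ⟨v, hv⟩ := v
  obtain ⟨h, rfl⟩ := exists_res_four hv
  refine huniq h ((opD_res μ h hv).symm.trans hs.1) fun k hk => ?_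
  exact hs.2 ⟨res 4 four_pos k, res_four_mem_H2 k⟩ ((opD_res μ k _).trans hk)

lemma mem_orthogonal_span_iff (w P : L2) : P ∈ (ℂ ∙ w)ᗮ ↔ ⟪w, P⟫_ℂ = 0 :=
  Submodule.mem_orthogonal_singleton_iff_inner_right

/-- The critical case `μ = 0`. -/
lemma exists_constrainedInverse_zero (hμ : (0 : ℝ) < 0 + 1) :
    ∃ B, IsConstrainedInverse 0 hμ B psiL2 := by
  obtain ⟨G, B, hB, hDG, hGD, hsymm, hc⟩ := exists_inverse 0 1 hμ opDR_zero_one_injective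
  obtain ⟨k, hk, hgap⟩ := exists_gap
  have hX : Xstar 0 = (ℂ ∙ psiL2)ᗮ := if_pos rfl
  have hGf : ∀ f, ⟪psiL2, f⟫_ℂ = 0 → ⟪psiL2, res 4 four_pos (G f)⟫_ℂ = 0 := by
    intro f hf
    have h1 := congrArg (fun u => ⟪psiL2, u⟫_ℂ) (hDG f)
    simp only [opDR_eq_add 0 1, inner_add_right, inner_psi_opDR, inner_smul_right, hf,
      Complex.ofReal_zero, Complex.ofReal_one, zero_mul, one_mul, zero_add] at h1
    exact (mul_eq_zero.1 h1).resolve_right (inner_self_ne_zero.2 psiL2_ne_zero)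
  have hDf : ∀ f, ⟪psiL2, f⟫_ℂ = 0 → opDR 0 0 (G f) = f := fun f hf => by
    rw [← opDR_eq_of_orthogonal 0 1 (hGf f hf), hDG]
  refine ⟨B, hsymm, hc, hX, ?_, ?_, ?_, ?_, ?_⟩
  · intro P hP
    rw [hX, mem_orthogonal_span_iff] at hP
    refine Dinv_eq_of_unique ⟨G P, hB P, hDf P hP⟩ ?_ ?_
    · intro k hk
      obtain ⟨c, hc⟩ := exists_eq_smul_psi (h := k) (by simp [hk])
      rw [hc, inner_smul_left, hB, hGf P hP, mul_zero]
    · intro h hh horth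
      have h1 := horth psiPre (by rw [opDR_psiPre]; simp)
      rw [res_psiPre] at h1
      rw [hB, ← hh, ← opDR_eq_of_orthogonal 0 1 h1, hGD]
  · intro P hP hP0
    rw [hX, mem_orthogonal_span_iff] at hP
    have h1 := hgap (G P) (hGf P hP)
    rw [hDf P hP, ← hB, inner_re_symm] at h1
    have h2 : B P ≠ 0 := by
      intro h0
      rw [hB] at h0
      exact hP0 (by rw [← hDG P, eq_zero_of_res_four_eq_zero h0, map_zero])
    have h3 : 0 < ‖B P‖ ^ 2 := by positivity
    exact pos_of_mul_pos_right (h3.trans_le h1) hk.le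
  · rw [hX, mem_orthogonal_span_iff, inner_psi_dphi]
    exact_mod_cast (psiMoment_pos three_pos).ne'
  · intro h _ _
    rw [hX, mem_orthogonal_span_iff, inner_psi_opDR]; simp
  · intro h hh
    rw [← opDR_eq_of_orthogonal 0 1 hh, hB, hGD]

/-- Away from `μ = 0` the operator `D_μ` is invertible, and only the sign of the form on the
constraint space is at stake. -/
lemma exists_constrainedInverse_of_injective {μ : ℝ} (hμ : 0 < μ + 1) (hμ0 : μ ≠ 0)
    (hinj : ∀ h, opDR μ 0 h = 0 → h = 0)
    (hne : ∀ h, opDR μ 0 h = dphiL2 → RCLike.re ⟪dphiL2, res 4 four_pos h⟫_ℂ ≠ 0)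
    (hpos : ∀ h k, opDR μ 0 k = dphiL2 → ⟪opDR μ 0 h, res 4 four_pos k⟫_ℂ = 0 → h ≠ 0 →
      0 < RCLike.re ⟪opDR μ 0 h, res 4 four_pos h⟫_ℂ) :
    ∃ B w, IsConstrainedInverse μ hμ B w := by
  obtain ⟨G, B, hB, hDG, hGD, hsymm, hc⟩ := exists_inverse μ 0 hμ hinj
  have hDinv : ∀ f, Dinv μ f = B f := fun f => by
    refine Dinv_eq_of_unique ⟨G f, hB f, hDG f⟩ (fun k hk => by simp [hinj k hk]) fun h hh _ => ?_
    rw [hB, ← hh, hGD]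
  have hX : Xstar μ = (ℂ ∙ B dphiL2)ᗮ := by rw [Xstar, if_neg hμ0, hDinv]
  refine ⟨B, B dphiL2, hsymm, hc, hX, fun P _ => hDinv P, ?_, ?_, ?_, ?_⟩
  · intro P hP hP0
    rw [hX, mem_orthogonal_span_iff] at hP
    have h1 := hpos (G P) (G dphiL2) (hDG _) (by rw [hDG, ← hB, ← inner_conj_symm, hP, map_zero])
      (fun h0 => hP0 (by rw [← hDG P, h0, map_zero]))
    rwa [hDG, ← hB, inner_re_symm] at h1
  · rw [hX, mem_orthogonal_span_iff]
    intro h0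
    have h1 := hne (G dphiL2) (hDG _)
    rw [← hB, inner_re_symm, h0, map_zero] at h1
    exact h1 rfl
  · intro h _ hh
    rw [hX, mem_orthogonal_span_iff, hsymm, hB, hGD, hh]
  · intro h _
    rw [hB, hGD]

lemma exists_constrainedInverse_of_pos {μ : ℝ} (hμ : 0 < μ + 1) (hμ0 : 0 < μ) :
    ∃ B w, IsConstrainedInverse μ hμ B w := by
  have hpos : ∀ h, h ≠ 0 → 0 < RCLike.re ⟪opDR μ 0 h, res 4 four_pos h⟫_ℂ := by
    intro h hh
    have h0 : res 4 four_pos h ≠ 0 := fun h0 => hh (eq_zero_of_res_four_eq_zero h0)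
    rw [re_inner_opDR]
    positivity
  refine exists_constrainedInverse_of_injective hμ hμ0.ne' ?_ ?_ fun h k _ _ hh => hpos h hh
  · intro h hh
    by_contra h0
    have := hpos h h0
    simp [hh] at this
  · intro h hh
    rw [← hh]
    refine (hpos h ?_).ne'
    rintro rfl
    exact dphiL2_ne_zero (by rw [← hh, map_zero])

/-- For `μ < 0` close to `0`, the form of `D_μ` has exactly one negative direction, and `D_μ⁻¹φ'` is
a negative vector; hence the form is positive on the complement of `D_μ⁻¹φ'`. -/
lemma exists_constrainedInverse_of_neg : ∃ δ : ℝ, 0 < δ ∧ ∀ μ : ℝ, -δ ≤ μ → μ < 0 →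
    ∀ hμ : 0 < μ + 1, ∃ B w, IsConstrainedInverse μ hμ B w := by
  obtain ⟨k, hk, hgap⟩ := exists_gap
  set b : ℝ := psiMoment 3 with hb
  have hb0 : 0 < b := psiMoment_pos three_pos
  set s : ℝ := ‖psiL2‖ ^ 2 with hs
  have hs0 : 0 < s := by have := norm_pos_iff.2 psiL2_ne_zero; positivity
  have hpp : ⟪psiL2, psiL2⟫_ℂ = (s : ℂ) := by
    rw [inner_self_eq_norm_sq_to_K, hs]; push_cast; rfl
  set E : ℝ := ‖dphiL2‖ with hE
  have hE0 : 0 < E := norm_pos_iff.2 dphiL2_ne_zero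
  refine ⟨min (1 / (2 * k)) (b ^ 2 / (4 * k * s * E ^ 2)), by positivity, fun μ hμ1 hμ2 hμ => ?_⟩
  have hμk : -(1 / (2 * k)) ≤ μ := (neg_le_neg (min_le_left _ _)).trans hμ1
  have hμb : -(b ^ 2 / (4 * k * s * E ^ 2)) ≤ μ := (neg_le_neg (min_le_right _ _)).trans hμ1
  -- the form is positive on the complement of `ψ`
  have hform : ∀ h : L2, ⟪psiL2, res 4 four_pos h⟫_ℂ = 0 →
      ‖res 4 four_pos h‖ ^ 2 ≤ 2 * k * RCLike.re ⟪opDR μ 0 h, res 4 four_pos h⟫_ℂ := by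
    intro h hh
    have h1 := hgap h hh
    have h2 : RCLike.re ⟪opDR μ 0 h, res 4 four_pos h⟫_ℂ =
        RCLike.re ⟪opDR 0 0 h, res 4 four_pos h⟫_ℂ + μ * ‖res 4 four_pos h‖ ^ 2 := by
      rw [re_inner_opDR, re_inner_opDR]; ring
    have h3 : -1 ≤ 2 * k * μ := by
      have := mul_le_mul_of_nonneg_left hμk (show 0 ≤ 2 * k by positivity)
      rwa [mul_neg, mul_one_div_cancel (by positivity)] at this
    rw [h2]
    nlinarith [sq_nonneg ‖res 4 four_pos h‖, mul_nonneg (sq_nonneg ‖res 4 four_pos h‖)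
      (by linarith : 0 ≤ 2 * k * μ + 1)]
  have hμC : (μ : ℂ) ≠ 0 := by exact_mod_cast hμ2.ne
  have hsC : (s : ℂ) ≠ 0 := by exact_mod_cast hs0.ne'
  have hneg : ∀ h, opDR μ 0 h = dphiL2 → RCLike.re ⟪dphiL2, res 4 four_pos h⟫_ℂ < 0 := by
    intro h hh
    have h1 : (b : ℂ) = μ * ⟪psiL2, res 4 four_pos h⟫_ℂ := by
      rw [← inner_psi_opDR, hh, inner_psi_dphi]
    set t : ℝ := b / (μ * s) with ht
    set h' := h - (t : ℂ) • psiPre with hh'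
    have hr : res 4 four_pos h' = res 4 four_pos h - (t : ℂ) • psiL2 := by
      rw [hh', map_sub, map_smul, res_psiPre]
    have h2 : ⟪psiL2, res 4 four_pos h'⟫_ℂ = 0 := by
      rw [hr, inner_sub_right, inner_smul_right, hpp, ht]
      push_cast
      rw [h1]
      field_simp
      ring
    have hD : opDR μ 0 h' = dphiL2 - ((t * μ : ℝ) : ℂ) • psiL2 := by
      rw [hh', map_sub, map_smul, hh, opDR_psiPre, smul_smul]; push_cast; rfl
    have h3 := hform h' h2
    have h4 : RCLike.re ⟪opDR μ 0 h', res 4 four_pos h'⟫_ℂ =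
        RCLike.re ⟪dphiL2, res 4 four_pos h'⟫_ℂ := by
      rw [hD, inner_sub_left, inner_smul_left, h2, mul_zero, sub_zero]
    rw [h4] at h3
    have h5 : RCLike.re ⟪dphiL2, res 4 four_pos h'⟫_ℂ ≤ E * ‖res 4 four_pos h'‖ :=
      re_inner_le_norm _ _
    have h6 : ‖res 4 four_pos h'‖ ≤ 2 * k * E := by
      rcases eq_or_lt_of_le (norm_nonneg (res 4 four_pos h')) with h0 | h0
      · rw [← h0]; positivity
      · have : ‖res 4 four_pos h'‖ * ‖res 4 four_pos h'‖ ≤ 2 * k * E * ‖res 4 four_pos h'‖ := by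
          nlinarith
        exact le_of_mul_le_mul_right this h0
    have h7 : RCLike.re ⟪dphiL2, res 4 four_pos h⟫_ℂ =
        t * b + RCLike.re ⟪dphiL2, res 4 four_pos h'⟫_ℂ := by
      have : res 4 four_pos h = res 4 four_pos h' + (t : ℂ) • psiL2 := by rw [hr]; abel
      rw [this, inner_add_right, inner_smul_right, ← inner_conj_symm dphiL2 psiL2, inner_psi_dphi,
        Complex.conj_ofReal, map_add, add_comm, RCLike.re_eq_complex_re, Complex.re_ofReal_mul,
        Complex.ofReal_re]
    have h8 : t * b = -(b ^ 2 / (-μ * s)) := by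
      rw [ht]; field_simp
    have h9 : 4 * k * E ^ 2 ≤ b ^ 2 / (-μ * s) := by
      rw [le_div_iff₀ (mul_pos (neg_pos.2 hμ2) hs0)]
      have := neg_le.1 hμb
      rw [le_div_iff₀ (by positivity)] at this
      linarith
    rw [h7, h8]
    have h10 : E * ‖res 4 four_pos h'‖ ≤ 2 * k * E ^ 2 := by nlinarith
    have h11 : 0 < k * E ^ 2 := by positivity
    linarith
  have hinj : ∀ h, opDR μ 0 h = 0 → h = 0 := by
    intro h hh
    have h1 := inner_psi_opDR μ h
    rw [hh, inner_zero_right] at h1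
    have h2 := hform h ((mul_eq_zero.1 h1.symm).resolve_left hμC)
    rw [hh, inner_zero_left, map_zero, mul_zero] at h2
    exact eq_zero_of_res_four_eq_zero (norm_eq_zero.1 ((pow_eq_zero_iff two_ne_zero).1
      (le_antisymm h2 (by positivity))))
  refine exists_constrainedInverse_of_injective hμ hμ2.ne hinj (fun h hh => (hneg h hh).ne) ?_
  intro h g hg horth hh0
  by_contra hle
  push Not at hle
  have hneg' := hneg g hg
  rw [← hg] at hneg'
  -- a combination of the two vectors orthogonal to `ψ`
  set α := ⟪psiL2, res 4 four_pos g⟫_ℂ with hα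
  set β := -⟪psiL2, res 4 four_pos h⟫_ℂ with hβ
  have hα0 : α ≠ 0 := by
    intro h0
    have h1 := inner_psi_opDR μ g
    rw [hg, inner_psi_dphi, ← hα, h0, mul_zero] at h1
    exact hb0.ne' (by exact_mod_cast h1)
  have horth' : ⟪opDR μ 0 g, res 4 four_pos h⟫_ℂ = 0 := by
    rw [inner_opDR, ← inner_conj_symm, horth, map_zero]
  have h1 : ⟪psiL2, res 4 four_pos (α • h + β • g)⟫_ℂ = 0 := by
    rw [map_add, map_smul, map_smul, inner_add_right, inner_smul_right, inner_smul_right, ← hα, hβ]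
    ring
  have h2 : RCLike.re ⟪opDR μ 0 (α • h + β • g), res 4 four_pos (α • h + β • g)⟫_ℂ =
      ‖α‖ ^ 2 * RCLike.re ⟪opDR μ 0 h, res 4 four_pos h⟫_ℂ +
        ‖β‖ ^ 2 * RCLike.re ⟪opDR μ 0 g, res 4 four_pos g⟫_ℂ := by
    have e : ⟪opDR μ 0 (α • h + β • g), res 4 four_pos (α • h + β • g)⟫_ℂ =
        ((‖α‖ ^ 2 : ℝ) : ℂ) * ⟪opDR μ 0 h, res 4 four_pos h⟫_ℂ +
          ((‖β‖ ^ 2 : ℝ) : ℂ) * ⟪opDR μ 0 g, res 4 four_pos g⟫_ℂ := by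
      simp only [map_add, map_smul, inner_add_left, inner_add_right, inner_smul_left,
        inner_smul_right, horth, horth', ← Complex.normSq_eq_norm_sq, Complex.normSq_eq_conj_mul_self]
      ring
    rw [e, map_add, RCLike.re_eq_complex_re, Complex.re_ofReal_mul, Complex.re_ofReal_mul]
  have h3 := hform _ h1
  rw [h2] at h3
  have h4 : α • h + β • g = 0 := by
    refine eq_zero_of_res_four_eq_zero (norm_eq_zero.1 ((pow_eq_zero_iff two_ne_zero).1
      (le_antisymm (h3.trans (mul_nonpos_of_nonneg_of_nonpos (by positivity) ?_)) (by positivity))))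
    exact add_nonpos (mul_nonpos_of_nonneg_of_nonpos (by positivity) hle)
      (mul_nonpos_of_nonneg_of_nonpos (by positivity) hneg'.le)
  have h5 : β = 0 := by
    have h6 := congrArg (fun u => ⟪opDR μ 0 u, res 4 four_pos g⟫_ℂ) h4
    simp only [map_add, map_smul, inner_add_left, inner_smul_left, horth, map_zero,
      inner_zero_left, mul_zero, zero_add] at h6
    rcases mul_eq_zero.1 h6 with h7 | h7
    · simpa using h7
    · rw [h7, map_zero] at hneg'
      exact absurd hneg' (lt_irrefl _)
  rw [h5, zero_smul, add_zero] at h4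
  exact hh0 ((smul_eq_zero.1 h4).resolve_left hα0)

/-! ### The trial function and the minimizer -/

/-- The form of `C`, conjugated by `(-∂² + 4)^(-1/2)`, as a bounded operator. -/
def opA : L2 →L[ℂ] L2 :=
  ContinuousLinearMap.id ℂ L2 - (6 : ℂ) • (opJ ∘L mulOp psiB ∘L mulOp psiB ∘L opJ)

lemma opA_apply (g : L2) : opA g = g - (6 : ℂ) • opJ (mulOp psiB (mulOp psiB (opJ g))) := rfl

lemma inner_opA (f g : L2) : ⟪opA f, g⟫_ℂ = ⟪f, opA g⟫_ℂ := by
  simp only [opA_apply, inner_sub_left, inner_sub_right, inner_smul_left, inner_smul_right,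
    inner_opJ, inner_mulOp_psi, map_ofNat]

lemma inner_opA_opJ (h : L2) :
    ⟪opA (opJ h), opJ h⟫_ℂ = ⟪opC ⟨res 4 four_pos h, res_four_mem_H2 h⟩, res 4 four_pos h⟫_ℂ := by
  rw [opC_res, ← opJ_opJ, opA_apply, ← inner_opJ _ (opJ h), map_sub, map_smul]

/-- `⟨C u, u⟩ = ‖u' + 2φu‖²`. -/
lemma re_inner_opA (g : L2) : RCLike.re ⟪opA g, g⟫_ℂ =
    ‖opN g + ((2 : ℕ) : ℂ) • mulOp phiB (opJ g)‖ ^ 2 := by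
  rw [norm_darboux_sq, opA_apply, inner_sub_left, inner_smul_left, inner_opJ, inner_mulOp_psi,
    map_ofNat, map_sub, inner_self_eq_norm_sq, show (6 : ℂ) = ((6 : ℝ) : ℂ) by norm_num,
    RCLike.re_eq_complex_re, Complex.re_ofReal_mul, ← RCLike.re_eq_complex_re,
    inner_self_eq_norm_sq]
  push_cast
  ring

lemma exists_eq_smul_dphi {g : L2} (hg : RCLike.re ⟪opA g, g⟫_ℂ = 0) :
    ∃ c : ℂ, opJ g = c • dphiL2 := by
  rw [re_inner_opA] at hg
  obtain ⟨c, hc⟩ := exists_eq_psi_pow_of_darboux_eq_zero 2 g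
    (norm_eq_zero.1 (pow_eq_zero_iff two_ne_zero |>.1 hg))
  refine ⟨c, ?_⟩
  apply Lp.ext
  filter_upwards [hc, dphi_memLp.coeFn_toLp, Lp.coeFn_smul c dphiL2] with x h1 h2 h3
  rw [h1, h3, Pi.smul_apply, dphiL2, h2, deriv_phi, smul_eq_mul]

lemma eq_zero_of_opJ_eq_zero {g : L2} (hg : opJ g = 0) : g = 0 :=
  eq_zero_of_res_four_eq_zero (by rw [← opJ_opJ, hg, map_zero])

lemma norm_opJ_sq_le (g : L2) : ‖opJ g‖ ^ 2 ≤ 4⁻¹ * ‖g‖ ^ 2 := by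
  have h1 : ‖opJ g‖ ^ 2 = RCLike.re ⟪res 4 four_pos g, g⟫_ℂ := by
    rw [← opJ_opJ, inner_opJ, inner_self_eq_norm_sq]
  rw [h1, sq, ← mul_assoc]
  exact (re_inner_le_norm _ _).trans
    (mul_le_mul_of_nonneg_right (norm_res_le 4 four_pos g) (norm_nonneg _))

/-- The trial function `D_μ f`, for `f = φψ^(1/4)`, lies below the threshold `4(μ + 1)` of the
essential spectrum. -/
lemma exists_trial {μ : ℝ} (hμ : 0 < μ + 1) (hμ1 : -(1 / 10) ≤ μ) {B : L2 →L[ℂ] L2} {w : L2}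
    (hB : IsConstrainedInverse μ hμ B w) :
    ∃ h, res 4 four_pos h ∈ Xstar μ ∧
      RCLike.re ⟪opC ⟨res 4 four_pos h, res_four_mem_H2 h⟩, res 4 four_pos h⟫_ℂ <
        4 * (μ + 1) * RCLike.re ⟪B (res 4 four_pos h), res 4 four_pos h⟫_ℂ := by
  have p1 : (0 : ℝ) < 1 / 4 := by norm_num
  have p2 : (0 : ℝ) < 9 / 4 := by norm_num
  have p3 : (0 : ℝ) < 17 / 4 := by norm_num
  set o1 := odL (1 / 4) p1 with ho1
  set o2 := odL (9 / 4) p2 with ho2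
  set o3 := odL (17 / 4) p3 with ho3
  have e12 : odL (1 / 4 + 2) (by norm_num) = o2 := by rw [ho2]; congr 1; norm_num
  have e23 : odL (9 / 4 + 2) (by norm_num) = o3 := by rw [ho3]; congr 1; norm_num
  have r1 : res 4 four_pos (((63 / 16 : ℝ) : ℂ) • o1 + ((45 / 16 : ℝ) : ℂ) • o2) = o1 := by
    conv_rhs => rw [ho1, odL_eq_res, e12]
    norm_num [ho1]
  have r2 : res 4 four_pos (((-17 / 16 : ℝ) : ℂ) • o2 + ((221 / 16 : ℝ) : ℂ) • o3) = o2 := by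
    conv_rhs => rw [ho2, odL_eq_res, e23]
    norm_num [ho2]
  have q1 : mulOp psiB (mulOp psiB o1) = o2 := by rw [ho1, mulOp_psi_psi_odL, e12]
  have q2 : mulOp psiB (mulOp psiB o2) = o3 := by rw [ho2, mulOp_psi_psi_odL, e23]
  set hf := ((63 / 16 : ℝ) : ℂ) • o1 + ((45 / 16 : ℝ) : ℂ) • o2 with hhf
  set h2 := ((-17 / 16 : ℝ) : ℂ) • o2 + ((221 / 16 : ℝ) : ℂ) • o3 with hh2
  set α : ℝ := μ + 15 / 16 with hα
  have f1 : ⟪psiL2, res 4 four_pos hf⟫_ℂ = 0 := by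
    rw [r1, psiL2_eq, ← inner_conj_symm, ho1, inner_odL_evL, map_zero]
  have f2 : ⟪dphiL2, res 4 four_pos hf⟫_ℂ = 0 := by
    rw [r1, dphiL2_eq, ← inner_conj_symm, ho1, inner_odL_evL, map_zero]
  have hP : res 4 four_pos ((α : ℂ) • hf + ((13 / 16 : ℝ) : ℂ) • h2) =
      (α : ℂ) • o1 + ((13 / 16 : ℝ) : ℂ) • o2 := by
    rw [map_add, map_smul, map_smul, r1, r2]
  have hD : opDR μ 0 hf = (α : ℂ) • o1 + ((13 / 16 : ℝ) : ℂ) • o2 := by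
    rw [opDR_apply, r1, q1, hhf, hα]
    push_cast
    module
  refine ⟨(α : ℂ) • hf + ((13 / 16 : ℝ) : ℂ) • h2, ?_, ?_⟩
  · rw [hP, ← hD]
    exact hB.opDR_mem hf f1 f2
  have hC : opC ⟨_, res_four_mem_H2 ((α : ℂ) • hf + ((13 / 16 : ℝ) : ℂ) • h2)⟩ =
      ((63 / 16 * α : ℝ) : ℂ) • o1 + ((-51 / 16 * α - 221 / 256 : ℝ) : ℂ) • o2 +
        ((1625 / 256 : ℝ) : ℂ) • o3 := by
    rw [opC_res, hP, map_add, map_add, map_smul, map_smul, map_smul, map_smul, q1, q2, hhf, hh2]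
    push_cast
    module
  have hBP : B (res 4 four_pos ((α : ℂ) • hf + ((13 / 16 : ℝ) : ℂ) • h2)) = o1 := by
    rw [hP, ← hD, hB.B_opDR hf f1, r1]
  rw [hC, hBP, hP]
  set M := psiMoment (1 / 2) with hM
  have hM0 : 0 < M := psiMoment_pos (by norm_num)
  have m1 : psiMoment (5 / 2) = M / 3 := by
    have := psiMoment_add_two (s := 1 / 2) (by norm_num)
    norm_num at this ⊢; linarith
  have m2 : psiMoment (9 / 2) = 5 / 21 * M := by
    have := psiMoment_add_two (s := 5 / 2) (by norm_num)
    rw [m1] at this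
    norm_num at this ⊢; linarith
  have m3 : psiMoment (13 / 2) = 15 / 77 * M := by
    have := psiMoment_add_two (s := 9 / 2) (by norm_num)
    rw [m2] at this
    norm_num at this ⊢; linarith
  have i11 : ⟪o1, o1⟫_ℂ = ((2 / 3 * M : ℝ) : ℂ) := by
    rw [ho1, inner_odL_odL]; congr 1; norm_num [← hM]; ring
  have i12 : ⟪o1, o2⟫_ℂ = ((2 / 21 * M : ℝ) : ℂ) := by
    rw [ho1, ho2, inner_odL_odL]; congr 1; norm_num [m1]; ring
  have i21 : ⟪o2, o1⟫_ℂ = ((2 / 21 * M : ℝ) : ℂ) := by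
    rw [← inner_conj_symm, i12, Complex.conj_ofReal]
  have i22 : ⟪o2, o2⟫_ℂ = ((10 / 231 * M : ℝ) : ℂ) := by
    rw [ho2, inner_odL_odL]; congr 1; norm_num [m2]; ring
  have i31 : ⟪o3, o1⟫_ℂ = ((10 / 231 * M : ℝ) : ℂ) := by
    rw [ho3, ho1, inner_odL_odL]; congr 1; norm_num [m2]; ring
  have i32 : ⟪o3, o2⟫_ℂ = ((2 / 77 * M : ℝ) : ℂ) := by
    rw [ho3, ho2, inner_odL_odL]; congr 1; norm_num [m3]; ring
  simp only [inner_add_left, inner_add_right, inner_smul_left, inner_smul_right, i11, i12, i21, i22,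
    i31, i32, Complex.conj_ofReal, ← Complex.ofReal_mul, ← Complex.ofReal_add,
    RCLike.re_eq_complex_re, Complex.ofReal_re]
  have hq : 0 < M * (29/84 * μ ^ 2 + 2729/3696 * μ + 6003/19712) :=
    mul_pos hM0 (by nlinarith [sq_nonneg μ])
  rw [← sub_pos, hα]
  refine hq.trans_eq ?_
  ring

/-- Existence and positivity of the constrained minimum, given the inverse on the constraint
space. -/
lemma exists_isLeast_rayleighValues {μ : ℝ} (hμ : 0 < μ + 1) (hμ1 : -(1 / 10) ≤ μ)
    {B : L2 →L[ℂ] L2} {w : L2} (hB : IsConstrainedInverse μ hμ B w) :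
    ∃ ρ : ℝ, IsLeast (rayleighValues μ) ρ ∧ 0 < ρ := by
  set V : Submodule ℂ L2 := (ℂ ∙ opJ w)ᗮ with hV
  have hmem : ∀ g, g ∈ V ↔ opJ g ∈ Xstar μ := fun g => by
    rw [hV, hB.Xstar_eq, mem_orthogonal_span_iff, mem_orthogonal_span_iff, inner_opJ]
  set S : L2 →L[ℂ] L2 := opJ ∘L B ∘L opJ with hS
  have hSinner : ∀ f g, ⟪S f, g⟫_ℂ = ⟪B (opJ f), opJ g⟫_ℂ := fun f g => inner_opJ _ _
  have hSpos : ∀ g ∈ V, g ≠ 0 → 0 < RCLike.re ⟪S g, g⟫_ℂ := fun g hg hg0 => by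
    rw [hSinner]
    exact hB.pos _ ((hmem g).1 hg) fun h0 => hg0 (eq_zero_of_opJ_eq_zero h0)
  have hApos : ∀ g, 0 ≤ RCLike.re ⟪opA g, g⟫_ℂ := fun g => by
    rw [re_inner_opA]; positivity
  obtain ⟨ρ, hρ0, g, hgV, hg0, hgρ, hmin, hEL⟩ := exists_rayleigh_min V
    (Submodule.isClosed_orthogonal _) opA S inner_opA
    (fun f g => by rw [hSinner, hB.symm]; exact inner_opJ _ _)
    (fun g _ => hApos g) hSpos (4 * (μ + 1))
    (by
      obtain ⟨h, hX, hlt⟩ := exists_trial hμ hμ1 hB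
      have e : ⟪S (opJ h), opJ h⟫_ℂ = ⟪B (res 4 four_pos h), res 4 four_pos h⟫_ℂ := by
        rw [hSinner, opJ_opJ]
      refine ⟨opJ h, (hmem _).2 (by rwa [opJ_opJ]), ?_, ?_⟩
      · intro h0
        rw [← inner_opA_opJ, ← e, h0] at hlt
        simp at hlt
      · rw [inner_opA_opJ, e]
        exact hlt)
    (by
      intro ρ hρ0 hρ
      refine ⟨ContinuousLinearMap.id ℂ L2 - (ρ : ℂ) • (opJ ∘L res (μ + 1) hμ ∘L opJ),
        -((6 : ℂ) • (opJ ∘L mulOp psiB ∘L mulOp psiB ∘L opJ)) -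
          (ρ : ℂ) • (opJ ∘L (B - res (μ + 1) hμ) ∘L opJ), 1 - ρ / (4 * (μ + 1)), ?_, ?_, ?_, ?_⟩
      · rw [gt_iff_lt, sub_pos, div_lt_one (by positivity)]
        exact hρ
      · ext1 f
        simp only [opA, hS, sub_apply, add_apply, smul_apply, neg_apply,
          ContinuousLinearMap.comp_apply, map_sub]
        module
      · intro f
        have h1 : RCLike.re ⟪res (μ + 1) hμ (opJ f), opJ f⟫_ℂ ≤ (μ + 1)⁻¹ * (4⁻¹ * ‖f‖ ^ 2) := by
          refine (re_inner_le_norm _ _).trans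
            ((mul_le_mul_of_nonneg_right (norm_res_le (μ + 1) hμ (opJ f)) (norm_nonneg _)).trans ?_)
          rw [mul_assoc, ← sq]
          exact mul_le_mul_of_nonneg_left (norm_opJ_sq_le f) (inv_nonneg.2 hμ.le)
        have h2 : RCLike.re ⟪(ContinuousLinearMap.id ℂ L2 -
            (ρ : ℂ) • (opJ ∘L res (μ + 1) hμ ∘L opJ)) f, f⟫_ℂ =
            ‖f‖ ^ 2 - ρ * RCLike.re ⟪res (μ + 1) hμ (opJ f), opJ f⟫_ℂ := by
          rw [sub_apply, smul_apply, ContinuousLinearMap.id_apply, ContinuousLinearMap.comp_apply,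
            ContinuousLinearMap.comp_apply, inner_sub_left, inner_smul_left, inner_opJ,
            Complex.conj_ofReal, map_sub, inner_self_eq_norm_sq, RCLike.re_eq_complex_re,
            Complex.re_ofReal_mul]
        rw [h2]
        have h3 := mul_le_mul_of_nonneg_left h1 hρ0
        have h4 : ρ * ((μ + 1)⁻¹ * (4⁻¹ * ‖f‖ ^ 2)) = ρ / (4 * (μ + 1)) * ‖f‖ ^ 2 := by
          field_simp
        linarith
      · refine IsCompactOperator.sub (IsCompactOperator.neg (IsCompactOperator.smul ?_ _))
          (IsCompactOperator.smul ?_ _)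
        · exact (isCompactOperator_psi_opJ.clm_comp (mulOp psiB)).clm_comp opJ
        · exact (hB.compact.comp_clm opJ).clm_comp opJ)
  -- the Euler–Lagrange equation puts the minimizer in the range of `(-∂² + 4)^(-1/2)`
  rw [hV, Submodule.orthogonal_orthogonal, Submodule.mem_span_singleton] at hEL
  obtain ⟨c, hc⟩ := hEL
  obtain ⟨h, rfl⟩ : ∃ h, g = opJ h := by
    refine ⟨(6 : ℂ) • mulOp psiB (mulOp psiB (opJ g)) + (ρ : ℂ) • B (opJ g) + c • w, ?_⟩
    rw [map_add, map_add, map_smul, map_smul, map_smul, hc, opA_apply]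
    change g = _ + (ρ : ℂ) • S g + _
    abel
  have hne : res 4 four_pos h ≠ 0 := fun h0 => hg0 (by
    rw [eq_zero_of_res_four_eq_zero h0, map_zero])
  have hX : res 4 four_pos h ∈ Xstar μ := by rw [← opJ_opJ]; exact (hmem _).1 hgV
  have hval : ∀ k, res 4 four_pos k ∈ Xstar μ →
      ⟪Dinv μ (res 4 four_pos k), res 4 four_pos k⟫_ℂ = ⟪S (opJ k), opJ k⟫_ℂ := fun k hk => by
    rw [hB.Dinv_eq _ hk, hSinner, opJ_opJ]
  refine ⟨ρ, ⟨⟨⟨res 4 four_pos h, res_four_mem_H2 h⟩, hne, hX, ?_⟩, ?_⟩, ?_⟩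
  · rw [hval h hX, ← inner_opA_opJ]
    exact (eq_div_iff (hSpos _ hgV hg0).ne').2 hgρ.symm
  · rintro _ ⟨⟨P, hP⟩, hP0, hPX, rfl⟩
    obtain ⟨k, rfl⟩ := exists_res_four hP
    have hk : opJ k ∈ V := (hmem _).2 (by rwa [opJ_opJ])
    have hk0 : opJ k ≠ 0 := fun h0 => hP0 (by
      change res 4 four_pos k = 0
      rw [← opJ_opJ, h0, map_zero])
    change ρ ≤ (⟪opC ⟨res 4 four_pos k, _⟩, res 4 four_pos k⟫_ℂ).re /
      (⟪Dinv μ (res 4 four_pos k), res 4 four_pos k⟫_ℂ).re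
    rw [hval k hPX, ← inner_opA_opJ]
    exact (le_div_iff₀ (hSpos _ hk hk0)).2 (hmin _ hk)
  · refine lt_of_le_of_ne hρ0 fun h0 => ?_
    rw [← h0, zero_mul] at hgρ
    obtain ⟨c, hc⟩ := exists_eq_smul_dphi hgρ
    rw [opJ_opJ] at hc
    refine hB.dphi_notMem ?_
    have hc0 : c ≠ 0 := by
      rintro rfl
      exact hne (by rw [hc, zero_smul])
    have h1 := (Xstar μ).smul_mem c⁻¹ hX
    rwa [hc, smul_smul, inv_mul_cancel₀ hc0, one_smul] at h1

end PNLS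

end

theorem mainTheorem2 :
    ∃ μs : ℝ, 0 < μs ∧ ∀ μ ∈ Set.Icc (-μs) 3,
      ∃ ρ : ℝ, IsLeast (PNLS.rayleighValues μ) ρ ∧ 0 < ρ := by
  obtain ⟨δ, hδ, hneg⟩ := PNLS.exists_constrainedInverse_of_neg
  refine ⟨min δ (1 / 10), by positivity, fun μ hμ => ?_⟩
  have h1 : -δ ≤ μ := (neg_le_neg (min_le_left _ _)).trans hμ.1
  have h2 : -(1 / 10) ≤ μ := (neg_le_neg (min_le_right _ _)).trans hμ.1
  have h3 : 0 < μ + 1 := by linarith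
  have h4 : ∃ B w, PNLS.IsConstrainedInverse μ h3 B w := by
    rcases lt_trichotomy μ 0 with h | rfl | h
    · exact hneg μ h1 h h3
    · obtain ⟨B, hB⟩ := PNLS.exists_constrainedInverse_zero h3
      exact ⟨B, _, hB⟩
    · exact PNLS.exists_constrainedInverse_of_pos h3 h
  obtain ⟨B, w, hB⟩ := h4
  exact PNLS.exists_isLeast_rayleighValues h3 h2 hB
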